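/- Consider the under-actuated ship, the control system with states $(x,y,\theta,z)\in\mathbb R^4$ and controls $(u_1,u_2)\in\mathbb R^2$ $$\dot x=u_1\cos\theta-z\sin\theta,\quad \dot y=u_1\sin\theta+z\cos\theta,\quad \dot\theta=u_2,\quad \dot z=-u_1u_2-z .$$ For $k\ge 0$ let $\mathrm{pr}^k\mathcal E$ be the system obtained by prolonging $u_2$ $k$ times; thus $\mathrm{pr}^4\mathcal E$ has states $(x,y,\theta,z,u_2,v_1,v_2,v_3)$, controls $(u_1,v_4)$ and the additional equations $\dot u_2=v_1,\ \dot v_1=v_2,\ \dot v_2=v_3,\ \dot v_3=v_4$. A control system $\dot{\mathbf x}=\mathbf f(t,\mathbf x,\mathbf u)$ is identified with the distribution spanned by $\mathbf T=\partial_t+\mathbf f\,\partial_{\mathbf x}$ and $\partial_{\mathbf u}$. A static feedback transformation between two control systems is a diffeomorphism between open sets, of the form $(t,\mathbf x,\mathbf u)\mapsto(t,\alpha(t,\mathbf x),\beta(t,\mathbf x,\mathbf u))$, that maps one distribution to the other. $\mathcal C\langle\rho_1,\dots,\rho_k\rangle$ denotes the Brunovsky normal form with $\rho_\ell$ chains of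 integrators of length $\ell$, that is, $\rho_\ell$ dependent variables $z_0$ of order $\ell$ with $\dot z_i=z_{i+1}$ for $0\le i<\ell$, where $z_\ell$ is a control. A system is static feedback linearizable near a point if on a neighbourhood of it some static feedback transformation identifies it with some $\mathcal C\langle\rho_1,\dots,\rho_k\rangle$. Put $$a=\big(2yu_2^2-x(v_1+u_2)\big)\sin\theta+\big(2xu_2^2+y(v_1+u_2)\big)\cos\theta+2zu_2,\qquad \ell=u_2^2+4u_2^4+2u_2v_2-3v_1^2 .$$ 1. The set $\{\ell\ne0\}$ is open and dense in the space of $(t,x,y,\theta,z,u_2,v_1,v_2,v_3,u_1,v_4)$, and on it the map $$\big(t;\ a,\mathbf Ta,\mathbf T^2a,\mathbf T^3a;\ \theta,\mathbf T\theta,\dots,\mathbf T^5\theta\big),$$ where $\mathbf T$ is the field of $\mathrm{pr}^4\mathcal E$, is a static feedback transformation (a diffeomorphism onto an open set) that identifies $\mathrm{pr}^4\mathcal E$ with $\mathcal C\langle0,0,1,0,1\rangle$. 2. For $k=0,1,2,3$, $\mathrm{pr}^k\mathcal E$ is not static feedback linearizable near any point; so four prolongations in the direction $\partial_{u_2}$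 are required. 3. The ship is flat, with flat output $(a,\theta)$, where $v_1=\dot u_2$ and $v_2=\ddot u_2$: the set of $(t,x,y,\theta,z,u,\dot u,\ddot u)$ with $\ell\neq0$ is open and dense; along smooth trajectories in this set the states and controls are smooth functions $F$ of $t$ and finitely many derivatives of $(a,\theta)$, $F$ being defined on an open set $W$; and $a,\theta$ are differentially independent: every smooth curve $t\mapsto(a(t),\theta(t))$ on an open interval whose jets lie in $W$ arises so from a trajectory in this set, which is the one given by $F$. -/

import Mathlib

open scoped ContDiff Topology

noncomputable section

namespace ShipControl

/-- A control system `ẋ = f (t, x, u)` with states indexed by `ι` and controls indexed by `μ`. -/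
abbrev ControlSystem (ι μ : Type) : Type :=
  ℝ → (ι → ℝ) → (μ → ℝ) → (ι → ℝ)

/-- The manifold of time, states and controls, with points `(t, x, u)`. -/
abbrev Phase (ι μ : Type) : Type := ℝ × (ι → ℝ) × (μ → ℝ)

/-- The vector field `T = ∂_t + f (t, x, u) ∂_x`. -/
def totalField {ι μ : Type} (S : ControlSystem ι μ) (p : Phase ι μ) : Phase ι μ :=
  (1, S p.1 p.2.1 p.2.2, 0)

/-- The distribution `{∂_t + f ∂_x, ∂_u}` of a control system. -/
def distribution {ι μ : Type} (S : ControlSystem ι μ) (p : Phase ι μ) :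
    Submodule ℝ (Phase ι μ) :=
  Submodule.span ℝ ({totalField S p} ∪ Set.range fun w : μ → ℝ => ((0, 0, w) : Phase ι μ))

/-- The derivative of a function along `T = ∂_t + f ∂_x`. -/
def totalDeriv {ι μ : Type} [Fintype ι] [Fintype μ] (S : ControlSystem ι μ)
    (h : Phase ι μ → ℝ) (p : Phase ι μ) : ℝ :=
  fderiv ℝ h p (totalField S p)

/-- One prolongation in the direction of the control `u_j`: the control `u_j` becomes the new
(last) state, and its derivative becomes the new `j`-th control. -/
def prolong {n : ℕ} {μ : Type} [DecidableEq μ] (S : ControlSystem (Fin n) μ) (j : μ) :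
    ControlSystem (Fin (n + 1)) μ :=
  fun t X v => Fin.snoc (α := fun _ => ℝ)
    (S t (fun i => X i.castSucc) (Function.update v j (X (Fin.last n)))) (v j)

/-- The `k`-fold prolongation in the direction of the control `u_j`. -/
def prolongIter {n : ℕ} {μ : Type} [DecidableEq μ] (S : ControlSystem (Fin n) μ) (j : μ) :
    (k : ℕ) → ControlSystem (Fin (n + k)) μ
  | 0 => S
  | k + 1 => prolong (prolongIter S j k) j

/-- The Brunovsky normal form with one chain of integrators
`ż^j_0 = z^j_1, …, ż^j_{κ_j - 1} = v_j` of length `κ_j` for every control `v_j`. -/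
def brunovsky {μ : Type} (κ : μ → ℕ) : ControlSystem (Σ j : μ, Fin (κ j)) μ :=
  fun _ z v q => if h : (q.2 : ℕ) + 1 < κ q.1 then z ⟨q.1, ⟨(q.2 : ℕ) + 1, h⟩⟩ else v q.1

/-- The index set of the dependent variables of `C⟨ρ_1, …, ρ_k⟩`: there are `ρ_ℓ` variables of
order `ℓ`. As `Fin k` starts at zero, `ρ ℓ` is the number of variables of order `ℓ + 1`. -/
abbrev SigIndex {k : ℕ} (ρ : Fin k → ℕ) : Type := Σ ℓ : Fin k, Fin (ρ ℓ)

/-- The order of a dependent variable of `C⟨ρ_1, …, ρ_k⟩`. -/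
abbrev sigOrder {k : ℕ} (ρ : Fin k → ℕ) (j : SigIndex ρ) : ℕ := (j.1 : ℕ) + 1

/-- The index set of the states of `C⟨ρ_1, …, ρ_k⟩`. -/
abbrev SigState {k : ℕ} (ρ : Fin k → ℕ) : Type := Σ j : SigIndex ρ, Fin (sigOrder ρ j)

/-- The Brunovsky normal form `C⟨ρ_1, …, ρ_k⟩` as a control system. -/
def contactSystem {k : ℕ} (ρ : Fin k → ℕ) : ControlSystem (SigState ρ) (SigIndex ρ) :=
  brunovsky (sigOrder ρ)

/-- `Φ` is an (extended) static feedback transformation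
`(t, x, u) ↦ (t, α (t, x), β (t, x, u))` that identifies the distributions of `S` and `S'`. -/
structure IsStaticFeedback {ι μ ι' μ' : Type} [Fintype ι] [Fintype μ] [Fintype ι'] [Fintype μ']
    (S : ControlSystem ι μ) (S' : ControlSystem ι' μ')
    (Φ : OpenPartialHomeomorph (Phase ι μ) (Phase ι' μ')) : Prop where
  smooth : ContDiffOn ℝ ∞ Φ Φ.source
  smooth_symm : ContDiffOn ℝ ∞ Φ.symm Φ.target
  form : ∃ (α : ℝ → (ι → ℝ) → (ι' → ℝ)) (β : ℝ → (ι → ℝ) → (μ → ℝ) → (μ' → ℝ)),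
    ∀ t x u, (t, x, u) ∈ Φ.source → Φ (t, x, u) = (t, α t x, β t x u)
  map_distribution : ∀ p ∈ Φ.source,
    (distribution S p).map (fderiv ℝ Φ p : Phase ι μ →ₗ[ℝ] Phase ι' μ') = distribution S' (Φ p)

/-- `S` is static feedback linearizable near `p`: on a neighbourhood of `p` some static feedback
transformation identifies it with a Brunovsky normal form. -/
def StaticFeedbackLinearizableAt {ι μ : Type} [Fintype ι] [Fintype μ] (S : ControlSystem ι μ)
    (p : Phase ι μ) : Prop :=
  ∃ (k : ℕ) (ρ : Fin k → ℕ)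
    (Φ : OpenPartialHomeomorph (Phase ι μ) (Phase (SigState ρ) (SigIndex ρ))),
    p ∈ Φ.source ∧ IsStaticFeedback S (contactSystem ρ) Φ

/-- The map to the space of `C⟨ρ_1, …, ρ_k⟩` obtained from functions `h_j`, one for every dependent
variable, by differentiating along `T`: `z^j_i = T^i h_j` for `i` up to the order of `j`. -/
def contactMap {ι μ : Type} [Fintype ι] [Fintype μ] (S : ControlSystem ι μ) {k : ℕ}
    (ρ : Fin k → ℕ) (h : SigIndex ρ → Phase ι μ → ℝ) (p : Phase ι μ) :
    Phase (SigState ρ) (SigIndex ρ) :=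
  (p.1, fun q => (totalDeriv S)^[(q.2 : ℕ)] (h q.1) p,
    fun j => (totalDeriv S)^[sigOrder ρ j] (h j) p)

/-- A smooth trajectory of a control system on a set of times (used for open intervals). -/
structure IsTrajectory {ι μ : Type} [Fintype ι] [Fintype μ] (S : ControlSystem ι μ) (I : Set ℝ)
    (x : ℝ → ι → ℝ) (u : ℝ → μ → ℝ) : Prop where
  smooth_state : ContDiffOn ℝ ∞ x I
  smooth_control : ContDiffOn ℝ ∞ u I
  ode : ∀ t ∈ I, HasDerivAt x (S t (x t) (u t)) t

/-- The `r`-jet `(y, ẏ, …, y^(r))` of a curve at time `t`. -/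
def jet {μ : Type} [Fintype μ] (r : ℕ) (y : ℝ → μ → ℝ) (t : ℝ) : Fin (r + 1) → μ → ℝ :=
  fun i => iteratedDeriv (i : ℕ) y t

/-- The space of `(t, x, u, u̇, …, u^(r))`. -/
abbrev ControlJet (ι μ : Type) (r : ℕ) : Type := ℝ × (ι → ℝ) × (Fin (r + 1) → μ → ℝ)

/-- `y = h (t, x, u, …, u^(r))` is a flat output on the open set `Ω`: it has as many components as
there are controls; along trajectories whose jets lie in `Ω` the state and the control are smooth
functions `F` of `t` and finitely many derivatives of `y`; and the components of `y` satisfy no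
differential relation, that is, every smooth curve `y` with jets in the (open) domain of `F` comes
in this way from a trajectory with jets in `Ω`, namely from `(x, u) = F (t, y, ẏ, …, y^(s))`. -/
def IsFlatOutputOn {ι μ : Type} [Fintype ι] [Fintype μ] (S : ControlSystem ι μ) (r : ℕ)
    (Ω : Set (ControlJet ι μ r)) (h : ControlJet ι μ r → μ → ℝ) : Prop :=
  IsOpen Ω ∧ ContDiffOn ℝ ∞ h Ω ∧
  ∃ (s : ℕ) (W : Set (ℝ × (Fin (s + 1) → μ → ℝ)))
    (F : ℝ × (Fin (s + 1) → μ → ℝ) → (ι → ℝ) × (μ → ℝ)),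
    IsOpen W ∧ ContDiffOn ℝ ∞ F W ∧
    (∀ (c d : ℝ) (x : ℝ → ι → ℝ) (u : ℝ → μ → ℝ),
      IsTrajectory S (Set.Ioo c d) x u →
      (∀ t ∈ Set.Ioo c d, (t, x t, jet r u t) ∈ Ω) →
      ∀ t ∈ Set.Ioo c d,
        (t, jet s (fun τ => h (τ, x τ, jet r u τ)) t) ∈ W ∧
        F (t, jet s (fun τ => h (τ, x τ, jet r u τ)) t) = (x t, u t)) ∧
    (∀ (c d : ℝ) (y : ℝ → μ → ℝ), ContDiffOn ℝ ∞ y (Set.Ioo c d) →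
      (∀ t ∈ Set.Ioo c d, (t, jet s y t) ∈ W) →
      IsTrajectory S (Set.Ioo c d) (fun t => (F (t, jet s y t)).1)
        (fun t => (F (t, jet s y t)).2) ∧
      ∀ t ∈ Set.Ioo c d,
        (t, (F (t, jet s y t)).1, jet r (fun τ => (F (τ, jet s y τ)).2) t) ∈ Ω ∧
        h (t, (F (t, jet s y t)).1, jet r (fun τ => (F (τ, jet s y τ)).2) t) = y t)

/-- A control system is (differentially) flat: on an open dense set of jets of some order it has,
locally, a flat output. -/
def IsFlat {ι μ : Type} [Fintype ι] [Fintype μ] (S : ControlSystem ι μ) : Prop :=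
  ∃ (r : ℕ) (D : Set (ControlJet ι μ r)), IsOpen D ∧ Dense D ∧
    ∀ p ∈ D, ∃ (Ω : Set (ControlJet ι μ r)) (h : ControlJet ι μ r → μ → ℝ),
      p ∈ Ω ∧ IsFlatOutputOn S r Ω h

/-- The under-actuated ship, with states `(x, y, θ, z)` and controls `(u₁, u₂)`:
`ẋ = u₁ cos θ - z sin θ`, `ẏ = u₁ sin θ + z cos θ`, `θ̇ = u₂`, `ż = -u₁ u₂ - z`. -/
def ship : ControlSystem (Fin 4) (Fin 2) := fun _ X u =>
  ![u 0 * Real.cos (X 2) - X 3 * Real.sin (X 2),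
    u 0 * Real.sin (X 2) + X 3 * Real.cos (X 2),
    u 1,
    -(u 0 * u 1) - X 3]

/-- The ship after `k` prolongations of `u₂`. For `k = 4` the states are
`(x, y, θ, z, u₂, v₁, v₂, v₃)` and the controls are `(u₁, v₄)`. -/
def shipPr (k : ℕ) : ControlSystem (Fin (4 + k)) (Fin 2) := prolongIter ship 1 k

/-- The function `a (x, y, θ, z, u₂, v₁)`. -/
def outputA (x y θ z u₂ v₁ : ℝ) : ℝ :=
  (2 * y * u₂ ^ 2 - x * (v₁ + u₂)) * Real.sin θ +
    (2 * x * u₂ ^ 2 + y * (v₁ + u₂)) * Real.cos θ + 2 * z * u₂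

/-- `ℓ = s₁² + 4 s₁⁴ + 2 s₁ s₃ - 3 s₂²`. -/
def ell (s₁ s₂ s₃ : ℝ) : ℝ := s₁ ^ 2 + 4 * s₁ ^ 4 + 2 * s₁ * s₃ - 3 * s₂ ^ 2

/-- The points of the four-fold prolongation at which `ℓ (u₂, v₁, v₂) ≠ 0`. -/
def regularSet : Set (Phase (Fin 8) (Fin 2)) :=
  {p | ell (p.2.1 4) (p.2.1 5) (p.2.1 6) ≠ 0}

/-- The signature `⟨0, 0, 1, 0, 1⟩`. -/
abbrev shipSig : Fin 5 → ℕ := ![0, 0, 1, 0, 1]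

/-- The functions to be differentiated: `a` for the dependent variable of order three, `θ` for the
one of order five. -/
def shipOutputs (j : SigIndex shipSig) (p : Phase (Fin 8) (Fin 2)) : ℝ :=
  if sigOrder shipSig j = 3 then
    outputA (p.2.1 0) (p.2.1 1) (p.2.1 2) (p.2.1 3) (p.2.1 4) (p.2.1 5)
  else p.2.1 2

/-- The jets `(t, x, u, u̇, ü)` of the ship at which `ℓ (u₂, u̇₂, ü₂) ≠ 0`. -/
def regularJets : Set (ControlJet (Fin 4) (Fin 2) 2) :=
  {p | ell (p.2.2 0 1) (p.2.2 1 1) (p.2.2 2 1) ≠ 0}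

/-- The pair `(a, θ)` as a function of `(t, x, u, u̇, ü)`. -/
def shipFlatOutput (p : ControlJet (Fin 4) (Fin 2) 2) : Fin 2 → ℝ :=
  ![outputA (p.2.1 0) (p.2.1 1) (p.2.1 2) (p.2.1 3) (p.2.2 0 1) (p.2.2 1 1), p.2.1 2]

end ShipControl

end

/-!
In the frame rotating with the ship, the jet `(a, T a, T² a, T³ a)` is a block triangular matrix,
with entries depending on the jet of `u₂ = T θ` only and with determinant `-ℓ³`, applied to the
coordinates `y cos θ - x sin θ`, `z + u₂ (x cos θ + y sin θ)`, `x cos θ + y sin θ` and `u₁`. Hence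
the jets of `a` and `θ` together are coordinates exactly where `ℓ ≠ 0`.

The obstruction to linearization is the filtration of the vector fields generated by `∂_u`, in which
a bracket with `T` raises the level by one and a bracket of two fields of the same level does not.
Static feedback carries it along. In a Brunovsky form with two chains the fields of level `m` have
components only along the controls and the top `m` states of each chain, so they span at most
`2 (m + 1)` directions. After fewer than four prolongations the bracket of `[∂_{u₁}, T]` or
`[[∂_{u₁}, T], T]` with a coordinate field of the jet of `u₂` yields `∂_z` at a level where there is
no room for it.

Flatness follows from the linearization: a trajectory of the ship lifts to its fourfold
prolongation, where the linearization turns it into the jet of the curve `(a, θ)`, and conversely.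
-/

noncomputable section

namespace ShipControl

section Distribution

variable {ι μ : Type} {S : ControlSystem ι μ} {p v : Phase ι μ}

lemma mem_distribution_iff : v ∈ distribution S p ↔ v.2.1 = v.1 • S p.1 p.2.1 p.2.2 := by
  constructor
  · intro hv
    induction hv using Submodule.span_induction with
    | mem v hv => rcases hv with rfl | ⟨w, rfl⟩ <;> simp [totalField]
    | zero => simp
    | add v w _ _ hv hw => simp [hv, hw, add_smul]
    | smul c v _ hv => simp [hv, mul_smul]
  · intro hv
    have decomposition : v = v.1 • totalField S p + ((0, 0, v.2.2) : Phase ι μ) := by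
      ext <;> simp [totalField, hv]
    rw [decomposition]
    exact add_mem (Submodule.smul_mem _ _ (Submodule.subset_span (Or.inl rfl)))
      (Submodule.subset_span (Or.inr ⟨v.2.2, rfl⟩))

lemma totalField_mem_distribution (S : ControlSystem ι μ) (p : Phase ι μ) :
    totalField S p ∈ distribution S p :=
  Submodule.subset_span (Or.inl rfl)

/-- The linear coordinates on a fibre of the distribution given by the coefficient of `T` and the
components along `∂_u`. -/
def distributionEquiv (S : ControlSystem ι μ) (p : Phase ι μ) :
    distribution S p ≃ₗ[ℝ] ℝ × (μ → ℝ) where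
  toFun v := (v.1.1, v.1.2.2)
  map_add' _ _ := rfl
  map_smul' _ _ := rfl
  invFun w := ⟨(w.1, w.1 • S p.1 p.2.1 p.2.2, w.2), mem_distribution_iff.2 rfl⟩
  left_inv v := by
    have hv := mem_distribution_iff.1 v.2
    ext <;> simp [hv]
  right_inv _ := rfl

lemma finrank_distribution [Fintype μ] (S : ControlSystem ι μ) (p : Phase ι μ) :
    Module.finrank ℝ (distribution S p) = 1 + Fintype.card μ := by
  simp [(distributionEquiv S p).finrank_eq]

end Distribution

section LocalDiffeomorphism

variable {𝕜 E F : Type*} [NontriviallyNormedField 𝕜] [NormedAddCommGroup E] [NormedSpace 𝕜 E]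
  [NormedAddCommGroup F] [NormedSpace 𝕜 F] {Φ : OpenPartialHomeomorph E F} {p : E}

lemma fderiv_symm_fderiv (hΦ : DifferentiableOn 𝕜 Φ Φ.source)
    (hΦ' : DifferentiableOn 𝕜 Φ.symm Φ.target) (hp : p ∈ Φ.source) (v : E) :
    fderiv 𝕜 Φ.symm (Φ p) (fderiv 𝕜 Φ p v) = v := by
  have hd := (hΦ.differentiableAt (Φ.open_source.mem_nhds hp)).hasFDerivAt
  have hd' := (hΦ'.differentiableAt (Φ.open_target.mem_nhds (Φ.map_source hp))).hasFDerivAt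
  have hid : Φ.symm ∘ Φ =ᶠ[𝓝 p] id := Φ.eventually_left_inverse hp
  exact congrArg (fun L => L v)
    ((hd'.comp p hd).congr_of_eventuallyEq hid.symm |>.unique (hasFDerivAt_id p))

lemma fderiv_injective (hΦ : DifferentiableOn 𝕜 Φ Φ.source)
    (hΦ' : DifferentiableOn 𝕜 Φ.symm Φ.target) (hp : p ∈ Φ.source) :
    Function.Injective (fderiv 𝕜 Φ p) :=
  Function.LeftInverse.injective (fderiv_symm_fderiv hΦ hΦ' hp)

lemma fderiv_fst_eq_of_time_preserving {Ψ : 𝕜 × E → 𝕜 × F} {p : 𝕜 × E}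
    (hΨ : DifferentiableAt 𝕜 Ψ p) (ht : ∀ᶠ q in 𝓝 p, (Ψ q).1 = q.1) (v : 𝕜 × E) :
    (fderiv 𝕜 Ψ p v).1 = v.1 := by
  have hfst : HasFDerivAt (fun q => (Ψ q).1) (ContinuousLinearMap.fst 𝕜 𝕜 _) p :=
    hasFDerivAt_fst.congr_of_eventuallyEq ht
  exact congrArg (fun L => L v) (hΨ.hasFDerivAt.fst.unique hfst)

lemma fderiv_control_state_eq_zero {U V : Type*} [NormedAddCommGroup U] [NormedSpace 𝕜 U]
    [NormedAddCommGroup V] [NormedSpace 𝕜 V] {Ψ : 𝕜 × E × U → 𝕜 × F × V} {p : 𝕜 × E × U}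
    (hΨ : DifferentiableAt 𝕜 Ψ p) {α : 𝕜 → E → F}
    (hα : ∀ᶠ q in 𝓝 p, (Ψ q).2.1 = α q.1 q.2.1) (w : U) :
    (fderiv 𝕜 Ψ p (0, 0, w)).2.1 = 0 := by
  have hconst : HasLineDerivAt 𝕜 (fun q : 𝕜 × E × U => α q.1 q.2.1) 0 p (0, 0, w) := by
    simpa [HasLineDerivAt] using hasDerivAt_const (0 : 𝕜) (α p.1 p.2.1)
  exact (hΨ.hasFDerivAt.snd.fst.hasLineDerivAt _).unique
    (hconst.congr_of_eventuallyEq hα)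

end LocalDiffeomorphism

section StaticFeedback

variable {ι μ ι' μ' : Type} [Fintype ι] [Fintype μ] [Fintype ι'] [Fintype μ']

namespace IsStaticFeedback

variable {S : ControlSystem ι μ} {S' : ControlSystem ι' μ'}
  {Φ : OpenPartialHomeomorph (Phase ι μ) (Phase ι' μ')} {p : Phase ι μ}

lemma apply_fst (h : IsStaticFeedback S S' Φ) (hp : p ∈ Φ.source) : (Φ p).1 = p.1 := by
  obtain ⟨α, β, hΦ⟩ := h.form
  rw [hΦ p.1 p.2.1 p.2.2 hp]

lemma differentiableOn (h : IsStaticFeedback S S' Φ) : DifferentiableOn ℝ Φ Φ.source :=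
  h.smooth.differentiableOn (by simp)

lemma differentiableOn_symm (h : IsStaticFeedback S S' Φ) :
    DifferentiableOn ℝ Φ.symm Φ.target :=
  h.smooth_symm.differentiableOn (by simp)

lemma card_control_eq (h : IsStaticFeedback S S' Φ) (hp : p ∈ Φ.source) :
    Fintype.card μ = Fintype.card μ' := by
  have hrank := (Submodule.equivMapOfInjective (fderiv ℝ Φ p : Phase ι μ →ₗ[ℝ] Phase ι' μ')
    (fderiv_injective h.differentiableOn h.differentiableOn_symm hp)
    (distribution S p)).finrank_eq
  rw [h.map_distribution p hp, finrank_distribution, finrank_distribution] at hrank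
  omega

lemma fderiv_totalField (h : IsStaticFeedback S S' Φ) (hp : p ∈ Φ.source) :
    (fderiv ℝ Φ p (totalField S p)).2.1 = S' (Φ p).1 (Φ p).2.1 (Φ p).2.2 := by
  have hsource := Φ.open_source.mem_nhds hp
  have hmem : fderiv ℝ Φ p (totalField S p) ∈ distribution S' (Φ p) :=
    h.map_distribution p hp ▸ Submodule.mem_map_of_mem (totalField_mem_distribution S p)
  rw [mem_distribution_iff.1 hmem, fderiv_fst_eq_of_time_preserving
    (h.differentiableOn.differentiableAt hsource)
    (Filter.eventually_of_mem hsource fun _ => h.apply_fst), totalField, one_smul]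

lemma of_fderiv_totalField (hs : ContDiffOn ℝ ∞ Φ Φ.source)
    (hs' : ContDiffOn ℝ ∞ Φ.symm Φ.target) (hcard : Fintype.card μ = Fintype.card μ')
    (hform : ∃ (α : ℝ → (ι → ℝ) → (ι' → ℝ)) (β : ℝ → (ι → ℝ) → (μ → ℝ) → (μ' → ℝ)),
      ∀ t x u, (t, x, u) ∈ Φ.source → Φ (t, x, u) = (t, α t x, β t x u))
    (hT : ∀ p ∈ Φ.source,
      (fderiv ℝ Φ p (totalField S p)).2.1 = S' (Φ p).1 (Φ p).2.1 (Φ p).2.2) :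
    IsStaticFeedback S S' Φ := by
  refine ⟨hs, hs', hform, fun p hp => ?_⟩
  obtain ⟨α, β, hΦ⟩ := hform
  have hsource := Φ.open_source.mem_nhds hp
  have hd := hs.differentiableOn (by simp)
  have htime := fderiv_fst_eq_of_time_preserving (hd.differentiableAt hsource)
    (Filter.eventually_of_mem hsource fun q hq => by rw [hΦ q.1 q.2.1 q.2.2 hq])
  have hcontrol := fderiv_control_state_eq_zero (α := α) (hd.differentiableAt hsource)
    (Filter.eventually_of_mem hsource fun q hq => by rw [hΦ q.1 q.2.1 q.2.2 hq])
  apply Submodule.eq_of_le_of_finrank_eq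
  · rw [distribution, Submodule.map_span_le]
    rintro v (rfl | ⟨w, rfl⟩) <;>
      rw [mem_distribution_iff, ContinuousLinearMap.coe_coe, htime]
    · rw [hT p hp, totalField, one_smul]
    · rw [hcontrol, zero_smul]
  · rw [← (Submodule.equivMapOfInjective (fderiv ℝ Φ p : Phase ι μ →ₗ[ℝ] Phase ι' μ')
      (fderiv_injective hd (hs'.differentiableOn (by simp)) hp)
      (distribution S p)).finrank_eq, finrank_distribution, finrank_distribution, hcard]

lemma of_contactMap {k : ℕ} {ρ : Fin k → ℕ} {h : SigIndex ρ → Phase ι μ → ℝ}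
    {Φ : OpenPartialHomeomorph (Phase ι μ) (Phase (SigState ρ) (SigIndex ρ))}
    (hs : ContDiffOn ℝ ∞ Φ Φ.source) (hs' : ContDiffOn ℝ ∞ Φ.symm Φ.target)
    (hcard : Fintype.card μ = Fintype.card (SigIndex ρ))
    (hΦ : ∀ p ∈ Φ.source, Φ p = contactMap S ρ h p)
    (hstate : ∃ α : ℝ → (ι → ℝ) → (SigState ρ → ℝ),
      ∀ t x u, (t, x, u) ∈ Φ.source → (contactMap S ρ h (t, x, u)).2.1 = α t x) :
    IsStaticFeedback S (contactSystem ρ) Φ := by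
  obtain ⟨α, hα⟩ := hstate
  refine of_fderiv_totalField hs hs' hcard
    ⟨α, fun t x u => (Φ (t, x, u)).2.2, fun t x u hp => ?_⟩ fun p hp => ?_
  · ext1
    · rw [hΦ _ hp]; rfl
    · ext1
      · rw [hΦ _ hp]; exact hα t x u hp
      · rfl
  · have hsource := Φ.open_source.mem_nhds hp
    funext q
    have hcoord : (fun p => (Φ p).2.1 q) =ᶠ[𝓝 p] (totalDeriv S)^[(q.2 : ℕ)] (h q.1) :=
      Filter.eventually_of_mem hsource fun p hp =>
        congrArg (fun z => z.2.1 q) (hΦ p hp)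
    have hderiv : HasFDerivAt (fun p => (Φ p).2.1 q) _ p := hasFDerivAt_pi'.1
      ((hs.differentiableOn (by simp)).differentiableAt hsource).hasFDerivAt.snd.fst q
    calc (fderiv ℝ Φ p (totalField S p)).2.1 q
        = fderiv ℝ (fun p => (Φ p).2.1 q) p (totalField S p) := by rw [hderiv.fderiv]; rfl
      _ = (totalDeriv S)^[(q.2 : ℕ) + 1] (h q.1) p := by
        rw [hcoord.fderiv_eq, Function.iterate_succ_apply', totalDeriv]
      _ = contactSystem ρ (Φ p).1 (Φ p).2.1 (Φ p).2.2 q := by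
        rw [hΦ p hp, contactSystem, brunovsky]
        split_ifs with hq
        · rfl
        · have hlast : (q.2 : ℕ) + 1 = sigOrder ρ q.1 := by omega
          rw [hlast]; rfl

end IsStaticFeedback

end StaticFeedback

section Trajectory

variable {ι μ ι' μ' : Type} [Fintype ι] [Fintype μ] [Fintype ι'] [Fintype μ']
  {S : ControlSystem ι μ} {S' : ControlSystem ι' μ'} {I : Set ℝ} {x : ℝ → ι → ℝ} {u : ℝ → μ → ℝ}

namespace IsTrajectory

lemma contDiffOn_graph (h : IsTrajectory S I x u) :
    ContDiffOn ℝ ∞ (fun t => ((t, x t, u t) : Phase ι μ)) I :=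
  contDiffOn_id.prodMk (h.smooth_state.prodMk h.smooth_control)

lemma map {Ψ : Phase ι μ → Phase ι' μ'} {U : Set (Phase ι μ)} (h : IsTrajectory S I x u)
    (hI : IsOpen I) (hU : IsOpen U) (hmem : ∀ t ∈ I, (t, x t, u t) ∈ U)
    (hΨ : ContDiffOn ℝ ∞ Ψ U) (htime : ∀ p ∈ U, (Ψ p).1 = p.1)
    (hdist : ∀ p ∈ U, ∀ v ∈ distribution S p, fderiv ℝ Ψ p v ∈ distribution S' (Ψ p)) :
    IsTrajectory S' I (fun t => (Ψ (t, x t, u t)).2.1) (fun t => (Ψ (t, x t, u t)).2.2) := by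
  have hsmooth := hΨ.comp h.contDiffOn_graph hmem
  refine ⟨hsmooth.snd.fst, hsmooth.snd.snd, fun t ht => ?_⟩
  have hu : HasDerivAt u (deriv u t) t := ((h.smooth_control.differentiableOn (by simp)
    ).differentiableAt (hI.mem_nhds ht)).hasDerivAt
  have hU' := hU.mem_nhds (hmem t ht)
  have hd : DifferentiableAt ℝ Ψ (t, x t, u t) :=
    (hΨ.differentiableOn (by simp)).differentiableAt hU'
  have hderiv := hd.hasFDerivAt.comp_hasDerivAt t ((hasDerivAt_id t).prodMk
    ((h.ode t ht).prodMk hu))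
  have hv := hdist _ (hmem t ht) (1, S t (x t) (u t), deriv u t)
    (mem_distribution_iff.2 (one_smul _ _).symm)
  have hfst := fderiv_fst_eq_of_time_preserving hd (Filter.eventually_of_mem hU' htime)
  rw [mem_distribution_iff, hfst, one_smul, htime _ (hmem t ht)] at hv
  exact hv ▸ hderiv.snd.fst

lemma map_isStaticFeedback {Φ : OpenPartialHomeomorph (Phase ι μ) (Phase ι' μ')}
    (h : IsTrajectory S I x u) (hI : IsOpen I) (hΦ : IsStaticFeedback S S' Φ)
    (hmem : ∀ t ∈ I, (t, x t, u t) ∈ Φ.source) :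
    IsTrajectory S' I (fun t => (Φ (t, x t, u t)).2.1) (fun t => (Φ (t, x t, u t)).2.2) :=
  h.map hI Φ.open_source hmem hΦ.smooth (fun _ => hΦ.apply_fst) fun p hp _ hv =>
    hΦ.map_distribution p hp ▸ Submodule.mem_map_of_mem hv

lemma map_isStaticFeedback_symm {Φ : OpenPartialHomeomorph (Phase ι' μ') (Phase ι μ)}
    (h : IsTrajectory S I x u) (hI : IsOpen I) (hΦ : IsStaticFeedback S' S Φ)
    (hmem : ∀ t ∈ I, (t, x t, u t) ∈ Φ.target) :
    IsTrajectory S' I (fun t => (Φ.symm (t, x t, u t)).2.1)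
      (fun t => (Φ.symm (t, x t, u t)).2.2) := by
  refine h.map hI Φ.open_target hmem hΦ.smooth_symm (fun q hq => ?_) fun q hq v hv => ?_
  · rw [← hΦ.apply_fst (Φ.map_target hq), Φ.right_inv hq]
  · obtain ⟨p, hp, rfl⟩ : ∃ p ∈ Φ.source, Φ p = q := ⟨_, Φ.map_target hq, Φ.right_inv hq⟩
    rw [← hΦ.map_distribution p hp] at hv
    obtain ⟨w, hw, rfl⟩ := hv
    rw [ContinuousLinearMap.coe_coe,
      fderiv_symm_fderiv hΦ.differentiableOn hΦ.differentiableOn_symm hp, Φ.left_inv hp]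
    exact hw

end IsTrajectory

end Trajectory

section ControlFiltration

open VectorField

variable {ι μ μ' : Type} [Fintype ι] [Fintype μ] {S : ControlSystem ι μ} {m : ℕ}

lemma lieBracket_const_left {E : Type*} [NormedAddCommGroup E] [NormedSpace ℝ E] (v : E)
    (W : E → E) (p : E) : lieBracket ℝ (fun _ => v) W p = fderiv ℝ W p v := by
  simp [lieBracket]

lemma fderiv_lieBracket_eq_zero {E : Type*} [NormedAddCommGroup E] [NormedSpace ℝ E]
    {U : Set E} (hU : IsOpen U) {f g : E → ℝ} {V W : E → E} (hf : ContDiffOn ℝ ∞ f U)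
    (hV : Differentiable ℝ V) (hW : Differentiable ℝ W) (hVf : ∀ x ∈ U, fderiv ℝ f x (V x) = 0)
    (hWf : ∀ x ∈ U, fderiv ℝ f x (W x) = g x) (hVg : ∀ x ∈ U, fderiv ℝ g x (V x) = 0) :
    ∀ x ∈ U, fderiv ℝ f x (lieBracket ℝ V W x) = 0 := by
  intro x hx
  have hWf' : (fun x => fderiv ℝ f x (W x)) =ᶠ[𝓝 x] g :=
    Filter.eventually_of_mem (hU.mem_nhds hx) hWf
  have hVf' : (fun x => fderiv ℝ f x (V x)) =ᶠ[𝓝 x] fun _ => 0 :=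
    Filter.eventually_of_mem (hU.mem_nhds hx) hVf
  have hsmooth : minSmoothness ℝ 2 ≤ (∞ : WithTop ℕ∞) := by
    rw [minSmoothness_of_isRCLikeNormedField]
    exact WithTop.coe_le_coe.2 le_top
  rw [fderiv_apply_lieBracket (hf.contDiffAt (hU.mem_nhds hx)) hsmooth (hW x) (hV x),
    hWf'.fderiv_eq, hVf'.fderiv_eq, hVg x hx, fderiv_fun_const]
  simp only [Pi.zero_apply, zero_apply, sub_zero]

/-- The filtration of the vector fields generated by the control directions `∂_u`, in which a
bracket with `T` raises the level by one and a bracket of two fields of level `m` has level `m`.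
It is carried along by static feedback transformations and bounds the rank of linearizable
systems. -/
inductive ControlField (S : ControlSystem ι μ) : ℕ → (Phase ι μ → Phase ι μ) → Prop
  | control (w : μ → ℝ) : ControlField S 0 fun _ => (0, 0, w)
  | succ {m V} : ControlField S m V → ControlField S (m + 1) V
  | ad {m V} : ControlField S m V → ControlField S (m + 1) (lieBracket ℝ V (totalField S))
  | bracket {m V W} : ControlField S m V → ControlField S m W →
      ControlField S m (lieBracket ℝ V W)

/-- The tangent vectors of the Brunovsky space that have components only along the controls and
along the `m` highest states of every chain. -/
def topSubmodule (κ : μ' → ℕ) (m : ℕ) : Submodule ℝ (Phase (Σ j, Fin (κ j)) μ') where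
  carrier := {v | v.1 = 0 ∧ ∀ q : Σ j, Fin (κ j), q.2 + m < κ q.1 → v.2.1 q = 0}
  zero_mem' := ⟨rfl, fun _ _ => rfl⟩
  add_mem' hv hw := ⟨by simp [hv.1, hw.1], fun q hq => by simp [hv.2 q hq, hw.2 q hq]⟩
  smul_mem' c v hv := ⟨by simp [hv.1], fun q hq => by simp [hv.2 q hq]⟩

lemma finrank_topSubmodule_le [Fintype μ'] (κ : μ' → ℕ) (m : ℕ) :
    Module.finrank ℝ (topSubmodule κ m) ≤ (m + 1) * Fintype.card μ' := by
  let L : topSubmodule κ m →ₗ[ℝ] (μ' → ℝ) × (Fin m × μ' → ℝ) :=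
    { toFun := fun v => (v.1.2.2, fun r =>
        if h : r.1 < κ r.2 then v.1.2.1 ⟨r.2, Fin.rev ⟨r.1, h⟩⟩ else 0)
      map_add' := fun v w => by ext r <;> simp; split_ifs <;> simp
      map_smul' := fun c v => by ext r <;> simp }
  have hL : Function.Injective L := by
    rw [← LinearMap.ker_eq_bot, LinearMap.ker_eq_bot']
    intro v hv
    obtain ⟨hcontrol, hstate⟩ := Prod.ext_iff.1 hv
    refine Subtype.ext (Prod.ext v.2.1 (Prod.ext (funext fun ⟨j, i⟩ => ?_) hcontrol))
    by_cases hi : (i : ℕ) + m < κ j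
    · exact v.2.2 ⟨j, i⟩ hi
    · have hrev : (i.rev : ℕ) < m := by rw [Fin.val_rev]; omega
      have hcoord : v.1.2.1 ⟨j, i.rev.rev⟩ = 0 :=
        (dif_pos i.rev.isLt).symm.trans (congrFun hstate (⟨i.rev, hrev⟩, j))
      rwa [Fin.rev_rev] at hcoord
  calc Module.finrank ℝ (topSubmodule κ m)
      ≤ Module.finrank ℝ ((μ' → ℝ) × (Fin m × μ' → ℝ)) :=
        LinearMap.finrank_le_finrank_of_injective hL
    _ = (m + 1) * Fintype.card μ' := by simp; ring

namespace ControlField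

variable {V W : Phase ι μ → Phase ι μ} {v : Phase ι μ}

lemma mono (h : ControlField S m V) {m' : ℕ} (hm : m ≤ m') : ControlField S m' V :=
  Nat.le_induction h (fun _ _ => succ) m' hm

lemma ad_const (h : ControlField S m fun _ => v)
    (hW : ∀ p, fderiv ℝ (totalField S) p v = W p) : ControlField S (m + 1) W :=
  (funext fun p => (lieBracket_const_left v (totalField S) p).trans (hW p)) ▸ h.ad

lemma bracket_const (h : ControlField S m fun _ => v) (hV : ControlField S m V)
    (hW : ∀ p, fderiv ℝ V p v = W p) : ControlField S m W :=
  (funext fun p => (lieBracket_const_left v V p).trans (hW p)) ▸ h.bracket hV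

lemma contDiff (hS : ContDiff ℝ ∞ (totalField S)) (h : ControlField S m V) :
    ContDiff ℝ ∞ V := by
  induction h with
  | control w => exact contDiff_const
  | succ _ ih => exact ih
  | ad _ ih => exact ih.lieBracket_vectorField hS (by simp)
  | bracket _ _ ih ih' => exact ih.lieBracket_vectorField ih' (by simp)

lemma differentiable (hS : ContDiff ℝ ∞ (totalField S)) (h : ControlField S m V) :
    Differentiable ℝ V :=
  (h.contDiff hS).differentiable (by simp)

lemma fst_eq_zero (hS : ContDiff ℝ ∞ (totalField S)) (h : ControlField S m V)
    (p : Phase ι μ) : (V p).1 = 0 := by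
  have hT := hS.differentiable (by simp)
  suffices key : ∀ x ∈ Set.univ, fderiv ℝ (Prod.fst : Phase ι μ → ℝ) x (V x) = 0 by
    simpa [fderiv_fst] using key p trivial
  induction h with
  | control w => intro p _; rw [fderiv_fst]; rfl
  | succ _ ih => exact ih
  | ad h ih =>
    exact fderiv_lieBracket_eq_zero isOpen_univ contDiff_fst.contDiffOn (h.differentiable hS) hT
      ih (g := fun _ => 1) (fun x _ => by rw [fderiv_fst]; rfl) (by simp)
  | bracket h h' ih ih' =>
    exact fderiv_lieBracket_eq_zero isOpen_univ contDiff_fst.contDiffOn (h.differentiable hS)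
      (h'.differentiable hS) ih ih' (by simp)

section Brunovsky

variable [Fintype μ'] {κ : μ' → ℕ} {p : Phase ι μ}
  {Φ : OpenPartialHomeomorph (Phase ι μ) (Phase (Σ j, Fin (κ j)) μ')}

lemma fderiv_mem_topSubmodule (hS : ContDiff ℝ ∞ (totalField S))
    (hΦ : IsStaticFeedback S (brunovsky κ) Φ) (h : ControlField S m V) (hp : p ∈ Φ.source) :
    fderiv ℝ Φ p (V p) ∈ topSubmodule κ m := by
  have hd : ∀ x ∈ Φ.source, DifferentiableAt ℝ Φ x := fun x hx =>
    hΦ.differentiableOn.differentiableAt (Φ.open_source.mem_nhds hx)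
  have hT := hS.differentiable (by simp)
  have hz : ∀ q : Σ j, Fin (κ j), ContDiffOn ℝ ∞ (fun x => (Φ x).2.1 q) Φ.source :=
    contDiffOn_pi.1 hΦ.smooth.snd.fst
  have hcoord : ∀ q : Σ j, Fin (κ j), ∀ x ∈ Φ.source, ∀ v,
      fderiv ℝ (fun x => (Φ x).2.1 q) x v = (fderiv ℝ Φ x v).2.1 q := fun q x hx v =>
    congrArg (fun L => L v) (hasFDerivAt_pi'.1 (hd x hx).hasFDerivAt.snd.fst q).fderiv
  suffices key : ∀ q : Σ j, Fin (κ j), q.2 + m < κ q.1 →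
      ∀ x ∈ Φ.source, fderiv ℝ (fun x => (Φ x).2.1 q) x (V x) = 0 by
    refine ⟨?_, fun q hq => hcoord q p hp _ ▸ key q hq p hp⟩
    rw [fderiv_fst_eq_of_time_preserving (hd p hp)
      (Filter.eventually_of_mem (Φ.open_source.mem_nhds hp) fun _ => hΦ.apply_fst),
      h.fst_eq_zero hS]
  induction h with
  | control w =>
    intro q _ x hx
    obtain ⟨α, β, hform⟩ := hΦ.form
    rw [hcoord q x hx, fderiv_control_state_eq_zero (α := α) (hd x hx)
      (Filter.eventually_of_mem (Φ.open_source.mem_nhds hx)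
        fun y hy => by rw [hform y.1 y.2.1 y.2.2 hy]), Pi.zero_apply]
  | succ _ ih => exact fun q hq => ih q (by omega)
  | ad h ih =>
    intro q hq
    have hnext : (q.2 : ℕ) + 1 < κ q.1 := by omega
    refine fderiv_lieBracket_eq_zero Φ.open_source (hz q) (h.differentiable hS) hT
      (ih q (by omega)) (fun x hx => ?_) (ih ⟨q.1, ⟨q.2 + 1, hnext⟩⟩ (by dsimp only; omega))
    rw [hcoord q x hx, hΦ.fderiv_totalField hx, brunovsky, dif_pos hnext]
  | bracket h h' ih ih' =>
    exact fun q hq => fderiv_lieBracket_eq_zero Φ.open_source (hz q) (h.differentiable hS)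
      (h'.differentiable hS) (ih q hq) (ih' q hq) (by simp)

lemma card_le_of_linearIndependent {τ : Type*} [Fintype τ] {V : τ → Phase ι μ → Phase ι μ}
    (hS : ContDiff ℝ ∞ (totalField S)) (hΦ : IsStaticFeedback S (brunovsky κ) Φ)
    (h : ∀ i, ControlField S m (V i)) (hp : p ∈ Φ.source)
    (hV : LinearIndependent ℝ fun i => V i p) :
    Fintype.card τ ≤ (m + 1) * Fintype.card μ := by
  have himage : LinearIndependent ℝ fun i => fderiv ℝ Φ p (V i p) :=
    hV.map' (fderiv ℝ Φ p).toLinearMap (LinearMap.ker_eq_bot.2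
      (fderiv_injective hΦ.differentiableOn hΦ.differentiableOn_symm hp))
  have hrestrict : LinearIndependent ℝ fun i =>
      (⟨_, (h i).fderiv_mem_topSubmodule hS hΦ hp⟩ : topSubmodule κ m) :=
    LinearIndependent.of_comp (topSubmodule κ m).subtype himage
  rw [hΦ.card_control_eq hp]
  exact hrestrict.fintype_card_le_finrank.trans (finrank_topSubmodule_le κ m)

end Brunovsky

end ControlField

lemma not_staticFeedbackLinearizableAt_of_dense {τ : Type*} [Fintype τ]
    {V : τ → Phase ι μ → Phase ι μ} (hS : ContDiff ℝ ∞ (totalField S))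
    (h : ∀ i, ControlField S m (V i)) (hcard : (m + 1) * Fintype.card μ < Fintype.card τ)
    (hV : Dense {p | LinearIndependent ℝ fun i => V i p}) (p : Phase ι μ) :
    ¬ StaticFeedbackLinearizableAt S p := by
  rintro ⟨k, ρ, Φ, hp, hΦ⟩
  obtain ⟨p', hp', hindep⟩ := hV.inter_open_nonempty _ Φ.open_source ⟨p, hp⟩
  exact hcard.not_ge (ControlField.card_le_of_linearIndependent hS hΦ h hp' hindep)

end ControlFiltration

section IteratedDeriv

variable {E : Type*} [NormedAddCommGroup E] [NormedSpace ℝ E] {I : Set ℝ} {t : ℝ}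

lemma contDiffOn_iteratedDeriv {y : ℝ → E} (hI : IsOpen I) (hy : ContDiffOn ℝ ∞ y I) (n : ℕ) :
    ContDiffOn ℝ ∞ (iteratedDeriv n y) I := by
  induction n with
  | zero => simpa only [iteratedDeriv_zero] using hy
  | succ n ih =>
    rw [iteratedDeriv_succ]
    exact ih.deriv_of_isOpen hI (by simp)

lemma hasDerivAt_iteratedDeriv {y : ℝ → E} (hI : IsOpen I) (hy : ContDiffOn ℝ ∞ y I) (n : ℕ)
    (ht : t ∈ I) : HasDerivAt (iteratedDeriv n y) (iteratedDeriv (n + 1) y t) t := by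
  rw [iteratedDeriv_succ]
  exact (((contDiffOn_iteratedDeriv hI hy n).contDiffAt (hI.mem_nhds ht)).differentiableAt
    (by simp)).hasDerivAt

lemma iteratedDeriv_eq_of_hasDerivAt (hI : IsOpen I) {N : ℕ} {g : Fin (N + 1) → ℝ → E}
    (hg : ∀ i : Fin N, ∀ t ∈ I, HasDerivAt (g i.castSucc) (g i.succ t) t) (i : Fin (N + 1))
    (ht : t ∈ I) : iteratedDeriv i (g 0) t = g i t := by
  induction i using Fin.induction generalizing t with
  | zero => rw [Fin.val_zero, iteratedDeriv_zero]
  | succ i ih =>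
    have heq : iteratedDeriv i (g 0) =ᶠ[𝓝 t] g i.castSucc :=
      Filter.eventually_of_mem (hI.mem_nhds ht) fun τ hτ => ih hτ
    rw [Fin.val_succ, iteratedDeriv_succ, heq.deriv_eq, (hg i t ht).deriv]

lemma iteratedDeriv_apply {μ : Type*} [Fintype μ] {y : ℝ → μ → ℝ} (hI : IsOpen I)
    (hy : ContDiffOn ℝ ∞ y I) (n : ℕ) (j : μ) (ht : t ∈ I) :
    iteratedDeriv n y t j = iteratedDeriv n (fun τ => y τ j) t :=
  (iteratedDeriv_eq_of_hasDerivAt hI (g := fun i : Fin (n + 1) => fun τ => iteratedDeriv i y τ j)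
    (fun i _ hτ => hasDerivAt_pi.1 (hasDerivAt_iteratedDeriv hI hy i hτ) j) (Fin.last n) ht).symm

end IteratedDeriv

section Brunovsky

variable {μ : Type} {κ : μ → ℕ}

/-- The `j`-th chain of integrators of a Brunovsky normal form, from the dependent variable up to
its highest derivative: the `κ j` states of the chain, followed by the `j`-th control. -/
def chainJet (κ : μ → ℕ) (j : μ) : Phase (Σ j, Fin (κ j)) μ →L[ℝ] (Fin (κ j + 1) → ℝ) :=
  .pi <| Fin.snoc (α := fun _ => Phase (Σ j, Fin (κ j)) μ →L[ℝ] ℝ)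
    (fun i => .proj ⟨j, i⟩ ∘L .fst ℝ _ _ ∘L .snd ℝ _ _)
    (.proj j ∘L .snd ℝ _ _ ∘L .snd ℝ _ _)

lemma chainJet_castSucc (j : μ) (p : Phase (Σ j, Fin (κ j)) μ) (i : Fin (κ j)) :
    chainJet κ j p i.castSucc = p.2.1 ⟨j, i⟩ := by
  simp [chainJet]

lemma chainJet_last (j : μ) (p : Phase (Σ j, Fin (κ j)) μ) :
    chainJet κ j p (Fin.last (κ j)) = p.2.2 j := by
  simp [chainJet]

lemma ext_chainJet {p q : Phase (Σ j, Fin (κ j)) μ} (ht : p.1 = q.1)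
    (hjet : ∀ j, chainJet κ j p = chainJet κ j q) : p = q := by
  refine Prod.ext ht (Prod.ext (funext fun ⟨j, i⟩ => ?_) (funext fun j => ?_))
  · simpa only [chainJet_castSucc] using congrFun (hjet j) i.castSucc
  · simpa only [chainJet_last] using congrFun (hjet j) (Fin.last (κ j))

lemma contDiff_of_chainJet [Fintype μ] {E : Type*} [NormedAddCommGroup E] [NormedSpace ℝ E]
    {f : E → Phase (Σ j, Fin (κ j)) μ} (ht : ContDiff ℝ ∞ fun x => (f x).1)
    (hjet : ∀ j, ContDiff ℝ ∞ fun x => chainJet κ j (f x)) : ContDiff ℝ ∞ f := by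
  refine ht.prodMk (.prodMk (contDiff_pi.2 fun ⟨j, i⟩ => ?_) (contDiff_pi.2 fun j => ?_))
  · simpa only [chainJet_castSucc] using contDiff_pi.1 (hjet j) i.castSucc
  · simpa only [chainJet_last] using contDiff_pi.1 (hjet j) (Fin.last (κ j))

lemma brunovsky_apply (p : Phase (Σ j, Fin (κ j)) μ) (j : μ) (i : Fin (κ j)) :
    brunovsky κ p.1 p.2.1 p.2.2 ⟨j, i⟩ = chainJet κ j p i.succ := by
  rw [brunovsky]
  split_ifs with hi
  · exact (chainJet_castSucc j p ⟨i + 1, hi⟩).symm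
  · have hlast : i.succ = Fin.last (κ j) :=
      Fin.ext (le_antisymm i.isLt (not_lt.1 hi))
    rw [hlast, chainJet_last]

variable {μ' : Type} {s : ℕ}

/-- The point of the Brunovsky normal form whose chains are the first derivatives in a jet
`(t, y, ẏ, …, y^(s))` of a curve, the components of `y` being matched with the chains by `e`. -/
def jetPoint (κ : μ → ℕ) (hs : ∀ j, κ j ≤ s) (e : μ' ≃ μ) (Y : ℝ × (Fin (s + 1) → μ' → ℝ)) :
    Phase (Σ j, Fin (κ j)) μ :=
  (Y.1, fun q => Y.2 (q.2.castLE ((hs q.1).trans (Nat.le_succ s))) (e.symm q.1),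
    fun j => Y.2 ⟨κ j, Nat.lt_succ_of_le (hs j)⟩ (e.symm j))

lemma chainJet_jetPoint (hs : ∀ j, κ j ≤ s) (e : μ' ≃ μ) (Y : ℝ × (Fin (s + 1) → μ' → ℝ))
    (j : μ) (i : Fin (κ j + 1)) :
    chainJet κ j (jetPoint κ hs e Y) i =
      Y.2 (i.castLE (Nat.succ_le_succ (hs j))) (e.symm j) := by
  induction i using Fin.lastCases with
  | last => rw [chainJet_last]; rfl
  | cast i => rw [chainJet_castSucc]; rfl

variable [Fintype μ] [Fintype μ']

lemma contDiff_jetPoint (hs : ∀ j, κ j ≤ s) (e : μ' ≃ μ) : ContDiff ℝ ∞ (jetPoint κ hs e) := by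
  unfold jetPoint
  fun_prop

variable {I : Set ℝ} {t : ℝ}

lemma isTrajectory_jetPoint (hs : ∀ j, κ j ≤ s) (e : μ' ≃ μ) {y : ℝ → μ' → ℝ} (hI : IsOpen I)
    (hy : ContDiffOn ℝ ∞ y I) :
    IsTrajectory (brunovsky κ) I (fun t => (jetPoint κ hs e (t, jet s y t)).2.1)
      (fun t => (jetPoint κ hs e (t, jet s y t)).2.2) where
  smooth_state := contDiffOn_pi.2 fun q =>
    contDiffOn_pi.1 (contDiffOn_iteratedDeriv hI hy q.2) (e.symm q.1)
  smooth_control := contDiffOn_pi.2 fun j =>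
    contDiffOn_pi.1 (contDiffOn_iteratedDeriv hI hy (κ j)) (e.symm j)
  ode t ht := hasDerivAt_pi.2 fun q =>
    (hasDerivAt_pi.1 (hasDerivAt_iteratedDeriv hI hy q.2 ht) (e.symm q.1)).congr_deriv
      ((brunovsky_apply (jetPoint κ hs e (t, jet s y t)) q.1 q.2).trans
        (chainJet_jetPoint hs e _ q.1 q.2.succ)).symm

lemma IsTrajectory.chainJet_eq_iteratedDeriv {z : ℝ → (Σ j, Fin (κ j)) → ℝ} {v : ℝ → μ → ℝ}
    (h : IsTrajectory (brunovsky κ) I z v) (hI : IsOpen I) (ht : t ∈ I) (j : μ)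
    (i : Fin (κ j + 1)) :
    chainJet κ j (t, z t, v t) i = iteratedDeriv i (fun τ => chainJet κ j (τ, z τ, v τ) 0) t := by
  refine (iteratedDeriv_eq_of_hasDerivAt hI (g := fun i τ => chainJet κ j (τ, z τ, v τ) i)
    (fun i τ hτ => ?_) i ht).symm
  simp only [chainJet_castSucc, ← brunovsky_apply (τ, z τ, v τ)]
  exact hasDerivAt_pi.1 (h.ode τ hτ) ⟨j, i⟩

lemma IsTrajectory.jetPoint_eq {z : ℝ → (Σ j, Fin (κ j)) → ℝ} {v : ℝ → μ → ℝ}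
    (h : IsTrajectory (brunovsky κ) I z v) (hI : IsOpen I) (hs : ∀ j, κ j ≤ s) (e : μ' ≃ μ)
    {y : ℝ → μ' → ℝ} (hy : ∀ t ∈ I, ∀ j, y t j = chainJet κ (e j) (t, z t, v t) 0) (ht : t ∈ I) :
    jetPoint κ hs e (t, jet s y t) = (t, z t, v t) := by
  have hsmooth : ContDiffOn ℝ ∞ y I := contDiffOn_pi.2 fun j =>
    (contDiffOn_pi.1 ((chainJet κ (e j)).contDiff.comp_contDiffOn h.contDiffOn_graph) 0).congr
      fun t ht => hy t ht j
  refine ext_chainJet rfl fun j => funext fun i => ?_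
  obtain ⟨l, rfl⟩ := e.surjective j
  have hchain : (fun τ => y τ l) =ᶠ[𝓝 t] fun τ => chainJet κ (e l) (τ, z τ, v τ) 0 :=
    Filter.eventually_of_mem (hI.mem_nhds ht) fun τ hτ => hy τ hτ l
  rw [chainJet_jetPoint, e.symm_apply_apply, h.chainJet_eq_iteratedDeriv hI ht,
    ← hchain.iteratedDeriv_eq]
  exact iteratedDeriv_apply hI hsmooth i l ht

end Brunovsky

section Prolongation

variable {n k : ℕ} {μ : Type}

/-- The states of the original system at a point of its `k`-fold prolongation. -/
def baseState (n k : ℕ) (μ : Type) : Phase (Fin (n + k)) μ →L[ℝ] (Fin n → ℝ) :=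
  .pi fun i => .proj (Fin.castAdd k i) ∘L .fst ℝ _ _ ∘L .snd ℝ _ _

/-- The control `u_j` and its first `k` derivatives at a point of the `k`-fold prolongation in the
direction of `u_j`: the `k` additional states, followed by the `j`-th control. -/
def prolongedJet (n k : ℕ) (j : μ) : Phase (Fin (n + k)) μ →L[ℝ] (Fin (k + 1) → ℝ) :=
  .pi <| Fin.snoc (α := fun _ => Phase (Fin (n + k)) μ →L[ℝ] ℝ)
    (fun i => .proj (Fin.natAdd n i) ∘L .fst ℝ _ _ ∘L .snd ℝ _ _)
    (.proj j ∘L .snd ℝ _ _ ∘L .snd ℝ _ _)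

lemma baseState_apply (p : Phase (Fin (n + k)) μ) (i : Fin n) :
    baseState n k μ p i = p.2.1 (Fin.castAdd k i) :=
  rfl

lemma prolongedJet_castSucc (j : μ) (p : Phase (Fin (n + k)) μ) (i : Fin k) :
    prolongedJet n k j p i.castSucc = p.2.1 (Fin.natAdd n i) := by
  simp [prolongedJet]

lemma prolongedJet_last (j : μ) (p : Phase (Fin (n + k)) μ) :
    prolongedJet n k j p (Fin.last k) = p.2.2 j := by
  simp [prolongedJet]

lemma prolongedJet_congr {j : μ} {p q : Phase (Fin (n + k)) μ} (h : p.2 = q.2) :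
    prolongedJet n k j p = prolongedJet n k j q := by
  funext i
  induction i using Fin.lastCases with
  | last => rw [prolongedJet_last, prolongedJet_last, h]
  | cast i => rw [prolongedJet_castSucc, prolongedJet_castSucc, h]

lemma baseState_congr {p q : Phase (Fin (n + k)) μ} (h : p.2.1 = q.2.1) :
    baseState n k μ p = baseState n k μ q := by
  funext i
  rw [baseState_apply, baseState_apply, h]

lemma prolongedJet_castSucc_congr {j : μ} {p q : Phase (Fin (n + k)) μ} (h : p.2.1 = q.2.1)
    (i : Fin k) : prolongedJet n k j p i.castSucc = prolongedJet n k j q i.castSucc := by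
  rw [prolongedJet_castSucc, prolongedJet_castSucc, h]

lemma ext_baseState_prolongedJet {j : μ} {p q : Phase (Fin (n + k)) μ} (ht : p.1 = q.1)
    (hbase : baseState n k μ p = baseState n k μ q)
    (hjet : prolongedJet n k j p = prolongedJet n k j q)
    (hcontrol : ∀ i ≠ j, p.2.2 i = q.2.2 i) : p = q := by
  refine Prod.ext ht (Prod.ext (funext fun i => ?_) (funext fun i => ?_))
  · induction i using Fin.addCases with
    | left i => exact congrFun hbase i
    | right i => simpa only [prolongedJet_castSucc] using congrFun hjet i.castSucc
  · rcases eq_or_ne i j with rfl | hi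
    · simpa only [prolongedJet_last] using congrFun hjet (Fin.last k)
    · exact hcontrol i hi

variable [DecidableEq μ] {j : μ} {t : ℝ}

/-- The controls of the original system at a point of its `k`-fold prolongation in the direction of
`u_j`. -/
def baseControl (n k : ℕ) (j : μ) (p : Phase (Fin (n + k)) μ) : μ → ℝ :=
  Function.update p.2.2 j (prolongedJet n k j p 0)

lemma baseControl_congr {p q : Phase (Fin (n + k)) μ} (h : p.2 = q.2) :
    baseControl n k j p = baseControl n k j q := by
  rw [baseControl, baseControl, prolongedJet_congr h, h]

lemma prolongIter_eq_append (S : ControlSystem (Fin n) μ) (j : μ) (k : ℕ)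
    (p : Phase (Fin (n + k)) μ) :
    prolongIter S j k p.1 p.2.1 p.2.2 =
      Fin.append
        (S p.1 (baseState n k μ p) (baseControl n k j p))
        (Fin.tail (prolongedJet n k j p)) := by
  induction k with
  | zero =>
    rw [prolongIter, baseControl, show prolongedJet n 0 j p 0 = p.2.2 j from prolongedJet_last j p,
      Function.update_eq_self, Fin.append_right_nil _ _ rfl]
    rfl
  | succ k ih =>
    let q : Phase (Fin (n + k)) μ := (p.1, fun i => p.2.1 i.castSucc,
      Function.update p.2.2 j (p.2.1 (Fin.last (n + k))))
    have hjet : prolongedJet n k j q = Fin.init (prolongedJet n (k + 1) j p) := by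
      funext i
      induction i using Fin.lastCases with
      | last =>
        rw [prolongedJet_last, Fin.init, prolongedJet_castSucc]
        exact Function.update_self ..
      | cast i => rw [prolongedJet_castSucc, Fin.init, prolongedJet_castSucc]; rfl
    have hcontrol : baseControl n k j q = baseControl n (k + 1) j p := by
      rw [baseControl, baseControl, hjet]
      exact Function.update_idem ..
    have hinit := ih q
    rw [hcontrol, hjet] at hinit
    refine (congrArg (Fin.snoc (α := fun _ => ℝ) · (p.2.2 j)) hinit).trans ?_
    rw [Fin.tail_init_eq_init_tail, ← prolongedJet_last (n := n) (k := k + 1) j p,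
      ← Fin.append_snoc]
    congr 1
    exact Fin.snoc_init_self (Fin.tail (prolongedJet n (k + 1) j p))

/-- The point of the `k`-fold prolongation in the direction of `u_j` over the point `(t, x, u)` of a
trajectory. -/
def prolongPoint (k : ℕ) (j : μ) (x : ℝ → Fin n → ℝ) (u : ℝ → μ → ℝ) (t : ℝ) :
    Phase (Fin (n + k)) μ :=
  (t, Fin.append (x t) fun i => iteratedDeriv i (fun τ => u τ j) t,
    Function.update (u t) j (iteratedDeriv k (fun τ => u τ j) t))

lemma baseState_prolongPoint (x : ℝ → Fin n → ℝ) (u : ℝ → μ → ℝ) :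
    baseState n k μ (prolongPoint k j x u t) = x t := by
  funext i
  simp only [baseState_apply, prolongPoint, Fin.append_left]

lemma prolongedJet_prolongPoint (x : ℝ → Fin n → ℝ) (u : ℝ → μ → ℝ) :
    prolongedJet n k j (prolongPoint k j x u t) =
      fun i : Fin (k + 1) => iteratedDeriv i (fun τ => u τ j) t := by
  funext i
  induction i using Fin.lastCases with
  | last => rw [prolongedJet_last]; exact Function.update_self ..
  | cast i => simp only [prolongedJet_castSucc, prolongPoint, Fin.append_right, Fin.val_castSucc]

lemma baseControl_prolongPoint (x : ℝ → Fin n → ℝ) (u : ℝ → μ → ℝ) :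
    baseControl n k j (prolongPoint k j x u t) = u t := by
  rw [baseControl, prolongedJet_prolongPoint]
  simp [prolongPoint]

variable [Fintype μ] {S : ControlSystem (Fin n) μ} {I : Set ℝ}

lemma contDiff_baseControl (n k : ℕ) (j : μ) : ContDiff ℝ ∞ (baseControl n k j) :=
  contDiff_pi.2 fun i => by
    rcases eq_or_ne i j with rfl | hi
    · simpa [baseControl] using contDiff_pi.1 (prolongedJet n k i).contDiff 0
    · simp only [baseControl, Function.update_of_ne hi]
      fun_prop

lemma IsTrajectory.lift_prolongIter {x : ℝ → Fin n → ℝ} {u : ℝ → μ → ℝ} (h : IsTrajectory S I x u)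
    (hI : IsOpen I) (j : μ) (k : ℕ) :
    IsTrajectory (prolongIter S j k) I (fun t => (prolongPoint k j x u t).2.1)
      (fun t => (prolongPoint k j x u t).2.2) := by
  have hu : ContDiffOn ℝ ∞ (fun τ => u τ j) I := contDiffOn_pi.1 h.smooth_control j
  refine ⟨contDiffOn_pi.2 fun i => ?_, contDiffOn_pi.2 fun i => ?_,
    fun t ht => hasDerivAt_pi.2 fun i => ?_⟩
  · induction i using Fin.addCases with
    | left i => simpa [prolongPoint] using contDiffOn_pi.1 h.smooth_state i
    | right i => simpa [prolongPoint] using contDiffOn_iteratedDeriv hI hu i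
  · rcases eq_or_ne i j with rfl | hi
    · simpa [prolongPoint] using contDiffOn_iteratedDeriv hI hu k
    · simpa [prolongPoint, hi] using contDiffOn_pi.1 h.smooth_control i
  · have hfield := prolongIter_eq_append S j k (prolongPoint k j x u t)
    rw [baseState_prolongPoint, baseControl_prolongPoint, prolongedJet_prolongPoint] at hfield
    refine HasDerivAt.congr_deriv ?_ (congrFun hfield i).symm
    induction i using Fin.addCases with
    | left i => simpa [prolongPoint] using hasDerivAt_pi.1 (h.ode t ht) i
    | right i => simpa [prolongPoint, Fin.tail] using hasDerivAt_iteratedDeriv hI hu i ht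

lemma IsTrajectory.project_prolongIter {X : ℝ → Fin (n + k) → ℝ} {v : ℝ → μ → ℝ}
    (h : IsTrajectory (prolongIter S j k) I X v) :
    IsTrajectory S I (fun t => baseState n k μ (t, X t, v t))
      (fun t => baseControl n k j (t, X t, v t)) where
  smooth_state := (baseState n k μ).contDiff.comp_contDiffOn h.contDiffOn_graph
  smooth_control := (contDiff_baseControl n k j).comp_contDiffOn h.contDiffOn_graph
  ode t ht := hasDerivAt_pi.2 fun i => by
    have hode := hasDerivAt_pi.1 (h.ode t ht) (Fin.castAdd k i)
    rwa [prolongIter_eq_append S j k (t, X t, v t), Fin.append_left] at hode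

lemma IsTrajectory.prolongedJet_eq_iteratedDeriv {X : ℝ → Fin (n + k) → ℝ} {v : ℝ → μ → ℝ}
    (h : IsTrajectory (prolongIter S j k) I X v) (hI : IsOpen I) (ht : t ∈ I)
    (i : Fin (k + 1)) :
    prolongedJet n k j (t, X t, v t) i =
      iteratedDeriv i (fun τ => prolongedJet n k j (τ, X τ, v τ) 0) t := by
  refine (iteratedDeriv_eq_of_hasDerivAt hI (g := fun i τ => prolongedJet n k j (τ, X τ, v τ) i)
    (fun i τ hτ => ?_) i ht).symm
  have hode := hasDerivAt_pi.1 (h.ode τ hτ) (Fin.natAdd n i)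
  rw [prolongIter_eq_append S j k (τ, X τ, v τ), Fin.append_right] at hode
  simp only [prolongedJet_castSucc]
  exact hode

end Prolongation

section Density

variable {E : Type*} [NormedAddCommGroup E] [NormedSpace ℝ E]

lemma dense_ne_zero_of_finite_line {f : E → ℝ} (e : E)
    (h : ∀ p, {s : ℝ | f (p + s • e) = 0}.Finite) : Dense {p | f p ≠ 0} := by
  intro p
  have hd : Dense {s : ℝ | f (p + s • e) ≠ 0} := (h p).countable.dense_compl ℝ
  have h0 := image_closure_subset_closure_image (f := fun s : ℝ => p + s • e) (by fun_prop)
    ⟨0, hd 0, rfl⟩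
  simp only [zero_smul, add_zero] at h0
  refine closure_mono ?_ h0
  rintro _ ⟨s, hs, rfl⟩
  exact hs

lemma finite_setOf_ell_eq_zero (s₂ s₃ : ℝ) : {s | ell s s₂ s₃ = 0}.Finite := by
  open Polynomial in
  let P : ℝ[X] := X ^ 2 + C 4 * X ^ 4 + C (2 * s₃) * X - C (3 * s₂ ^ 2)
  have hP : P ≠ 0 := fun h => by
    simpa [P, Polynomial.coeff_X, Polynomial.coeff_C, -map_mul, -map_pow] using
      congrArg (fun Q => Q.coeff 4) h
  refine P.roots.toFinset.finite_toSet.subset fun s hs => ?_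
  have hroot : P.eval s = 0 := by
    rw [Set.mem_ofPred_eq, ell] at hs
    simp only [P, Polynomial.eval_sub, Polynomial.eval_add, Polynomial.eval_mul,
      Polynomial.eval_pow, Polynomial.eval_X, Polynomial.eval_C]
    linear_combination hs
  simpa [hP] using hroot

end Density

section Smooth

@[fun_prop]
lemma contDiff_vecCons {E F : Type*} [NormedAddCommGroup E] [NormedSpace ℝ E]
    [NormedAddCommGroup F] [NormedSpace ℝ F] {n : ℕ} {f : E → F} {g : E → Fin n → F}
    (hf : ContDiff ℝ ∞ f) (hg : ContDiff ℝ ∞ g) :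
    ContDiff ℝ ∞ fun x => Matrix.vecCons (f x) (g x) :=
  contDiff_pi.2 (Fin.cases hf (contDiff_pi.1 hg))

variable {n : ℕ} {μ : Type} [Fintype μ] [DecidableEq μ] {S : ControlSystem (Fin n) μ}

lemma contDiff_totalField_prolongIter (hS : ContDiff ℝ ∞ (totalField S)) (j : μ) (k : ℕ) :
    ContDiff ℝ ∞ (totalField (prolongIter S j k)) := by
  refine contDiff_const.prodMk ((contDiff_pi.2 fun i => ?_).prodMk contDiff_const)
  simp only [prolongIter_eq_append]
  induction i using Fin.addCases with
  | left i =>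
    simp only [Fin.append_left]
    exact contDiff_pi.1 (hS.comp (contDiff_fst.prodMk ((baseState n k μ).contDiff.prodMk
      (contDiff_baseControl n k j)))).snd.fst i
  | right i =>
    simpa only [Fin.append_right, Fin.tail] using contDiff_pi.1 (prolongedJet n k j).contDiff i.succ

end Smooth

section ShipFields

open Real

variable {k : ℕ}

/-- The tangent vector of the `k`-fold prolongation of the ship with components `b` along the four
states, `u` along `u₁` and `s` along `u₂` and its derivatives. -/
def tangentVector (k : ℕ) :
    (Fin 4 → ℝ) × ℝ × (Fin (k + 1) → ℝ) →L[ℝ] Phase (Fin (4 + k)) (Fin 2) :=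
  LinearMap.toContinuousLinearMap
    { toFun := fun v => (0, Fin.append v.1 (Fin.init v.2.2), ![v.2.1, v.2.2 (Fin.last k)])
      map_add' := fun v w => by
        refine Prod.ext (add_zero 0).symm (Prod.ext (funext fun i => ?_) (funext fun i => ?_))
        · induction i using Fin.addCases <;> simp [Fin.init]
        · fin_cases i <;> simp
      map_smul' := fun c v => by
        refine Prod.ext (mul_zero c).symm (Prod.ext (funext fun i => ?_) (funext fun i => ?_))
        · induction i using Fin.addCases <;> simp [Fin.init]
        · fin_cases i <;> simp }

lemma baseState_tangentVector (b : Fin 4 → ℝ) (w : ℝ × (Fin (k + 1) → ℝ)) :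
    baseState 4 k (Fin 2) (tangentVector k (b, w)) = b := by
  funext i
  simp [baseState_apply, tangentVector]

lemma prolongedJet_tangentVector (b : Fin 4 → ℝ) (u : ℝ) (s : Fin (k + 1) → ℝ) :
    prolongedJet 4 k 1 (tangentVector k (b, u, s)) = s := by
  funext i
  induction i using Fin.lastCases with
  | last => simp [prolongedJet_last, tangentVector]
  | cast i => simp [prolongedJet_castSucc, tangentVector, Fin.init]

lemma injective_tangentVector : Function.Injective (tangentVector k) := fun v w h => by
  have hb := congrArg (baseState 4 k (Fin 2)) h
  have hu := congrArg (fun p : Phase (Fin (4 + k)) (Fin 2) => p.2.2 0) h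
  have hs := congrArg (prolongedJet 4 k (1 : Fin 2)) h
  rw [baseState_tangentVector, baseState_tangentVector] at hb
  rw [prolongedJet_tangentVector, prolongedJet_tangentVector] at hs
  exact Prod.ext hb (Prod.ext hu hs)

lemma contDiff_totalField_ship : ContDiff ℝ ∞ (totalField ship) := by
  unfold totalField ship
  fun_prop

lemma contDiff_totalField_shipPr (k : ℕ) : ContDiff ℝ ∞ (totalField (shipPr k)) :=
  contDiff_totalField_prolongIter contDiff_totalField_ship 1 k

lemma shipPr_apply (p : Phase (Fin (4 + k)) (Fin 2)) :
    shipPr k p.1 p.2.1 p.2.2 =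
      Fin.append (ship p.1 (baseState 4 k (Fin 2) p) ![p.2.2 0, prolongedJet 4 k 1 p 0])
        (Fin.tail (prolongedJet 4 k 1 p)) := by
  rw [shipPr, prolongIter_eq_append]
  congr 2
  funext i
  fin_cases i <;> rfl

lemma baseState_totalField (p : Phase (Fin (4 + k)) (Fin 2)) :
    baseState 4 k (Fin 2) (totalField (shipPr k) p) =
      ship p.1 (baseState 4 k (Fin 2) p) ![p.2.2 0, prolongedJet 4 k 1 p 0] := by
  funext i
  simp only [baseState_apply, totalField, shipPr_apply, Fin.append_left]

lemma prolongedJet_totalField (p : Phase (Fin (4 + k)) (Fin 2)) (i : Fin k) :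
    prolongedJet 4 k 1 (totalField (shipPr k) p) i.castSucc = prolongedJet 4 k 1 p i.succ := by
  simp only [prolongedJet_castSucc, totalField, shipPr_apply, Fin.append_right, Fin.tail]

lemma hasDerivAt_ship {X : ℝ → Fin 4 → ℝ} {u : ℝ → Fin 2 → ℝ} {X' : Fin 4 → ℝ} {u' : Fin 2 → ℝ}
    {τ : ℝ} (t : ℝ) (hX : HasDerivAt X X' τ) (hu : HasDerivAt u u' τ) :
    HasDerivAt (fun τ => ship t (X τ) (u τ))
      ![u' 0 * cos (X τ 2) - u τ 0 * sin (X τ 2) * X' 2 - X' 3 * sin (X τ 2) -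
          X τ 3 * cos (X τ 2) * X' 2,
        u' 0 * sin (X τ 2) + u τ 0 * cos (X τ 2) * X' 2 + X' 3 * cos (X τ 2) -
          X τ 3 * sin (X τ 2) * X' 2,
        u' 1, -(u' 0 * u τ 1 + u τ 0 * u' 1) - X' 3] τ := by
  rw [hasDerivAt_pi] at hX hu ⊢
  intro i
  fin_cases i
  · exact (((hu 0).mul (hX 2).cos).sub ((hX 3).mul (hX 2).sin)).congr_deriv (by simp; ring)
  · exact (((hu 0).mul (hX 2).sin).add ((hX 3).mul (hX 2).cos)).congr_deriv (by simp; ring)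
  · exact hu 1
  · exact ((hu 0).mul (hu 1)).neg.sub (hX 3)

lemma hasDerivAt_append {n : ℕ} {f : ℝ → Fin n → ℝ} {g : ℝ → Fin k → ℝ} {f' : Fin n → ℝ}
    {g' : Fin k → ℝ} {τ : ℝ} (hf : HasDerivAt f f' τ) (hg : HasDerivAt g g' τ) :
    HasDerivAt (fun τ => Fin.append (f τ) (g τ)) (Fin.append f' g') τ := by
  rw [hasDerivAt_pi] at hf hg ⊢
  intro i
  induction i using Fin.addCases with
  | left i => simpa only [Fin.append_left] using hf i
  | right i => simpa only [Fin.append_right] using hg i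

lemma fderiv_totalField_shipPr (p : Phase (Fin (4 + k)) (Fin 2)) (b : Fin 4 → ℝ) (u : ℝ)
    (s : Fin (k + 1) → ℝ) :
    fderiv ℝ (totalField (shipPr k)) p (tangentVector k (b, u, s)) = tangentVector k
      (![u * cos (baseState 4 k _ p 2) - p.2.2 0 * sin (baseState 4 k _ p 2) * b 2 -
            b 3 * sin (baseState 4 k _ p 2) -
            baseState 4 k _ p 3 * cos (baseState 4 k _ p 2) * b 2,
          u * sin (baseState 4 k _ p 2) + p.2.2 0 * cos (baseState 4 k _ p 2) * b 2 +
            b 3 * cos (baseState 4 k _ p 2) -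
            baseState 4 k _ p 3 * sin (baseState 4 k _ p 2) * b 2,
          s 0, -(u * prolongedJet 4 k 1 p 0 + p.2.2 0 * s 0) - b 3], 0,
        Fin.snoc (α := fun _ => ℝ) (Fin.tail s) 0) := by
  have hline {F : Type} [NormedAddCommGroup F] [NormedSpace ℝ F]
      (L : Phase (Fin (4 + k)) (Fin 2) →L[ℝ] F) :
      HasDerivAt (fun τ : ℝ => L (p + τ • tangentVector k (b, u, s)))
        (L (tangentVector k (b, u, s))) 0 :=
    L.hasFDerivAt.hasLineDerivAt _
  have hbase := hline (baseState 4 k (Fin 2))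
  have hjet := hline (prolongedJet 4 k 1)
  have hcontrol := hline (.proj 0 ∘L .snd ℝ _ _ ∘L .snd ℝ _ _)
  rw [baseState_tangentVector] at hbase
  rw [prolongedJet_tangentVector] at hjet
  have hu : HasDerivAt (fun τ : ℝ => ![(p + τ • tangentVector k (b, u, s)).2.2 0,
      prolongedJet 4 k 1 (p + τ • tangentVector k (b, u, s)) 0]) ![u, s 0] 0 :=
    hasDerivAt_pi.2 (Fin.forall_fin_two.2 ⟨hcontrol, hasDerivAt_pi.1 hjet 0⟩)
  have hT := (hasDerivAt_const (0 : ℝ) (1 : ℝ)).prodMk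
    ((hasDerivAt_append (hasDerivAt_ship 0 hbase hu) (hasDerivAt_pi.2 fun i : Fin k =>
      hasDerivAt_pi.1 hjet i.succ)).prodMk (hasDerivAt_const 0 (0 : Fin 2 → ℝ)))
  refine (((contDiff_totalField_shipPr k).differentiable (by simp)).differentiableAt
    |>.hasFDerivAt.hasLineDerivAt _).unique (HasDerivAt.congr_deriv (f := fun τ => totalField
      (shipPr k) (p + τ • tangentVector k (b, u, s))) (hT.congr_of_eventuallyEq ?_) ?_)
  · exact .of_forall fun τ => Prod.ext rfl (Prod.ext (shipPr_apply _) rfl)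
  · simp [tangentVector, ← Matrix.zero_empty, Fin.tail_def]

end ShipFields

section ShipBrackets

open Real

variable {k m : ℕ} {p v : Phase (Fin (4 + k)) (Fin 2)}

/-- The components along the states of the ship of the field `[∂_{u₁}, T]`. -/
def surge (p : Phase (Fin (4 + k)) (Fin 2)) : Fin 4 → ℝ :=
  ![cos (baseState 4 k _ p 2), sin (baseState 4 k _ p 2), 0, -prolongedJet 4 k 1 p 0]

/-- The components along the states of the ship of the field `[[∂_{u₁}, T], T]` after at least one
prolongation. -/
def sway (p : Phase (Fin (4 + (k + 1))) (Fin 2)) : Fin 4 → ℝ :=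
  ![2 * prolongedJet 4 (k + 1) 1 p 0 * sin (baseState 4 (k + 1) _ p 2),
    -(2 * prolongedJet 4 (k + 1) 1 p 0 * cos (baseState 4 (k + 1) _ p 2)), 0,
    prolongedJet 4 (k + 1) 1 p 0 + prolongedJet 4 (k + 1) 1 p 1]

lemma contDiff_surge : ContDiff ℝ ∞ (surge (k := k)) := by
  unfold surge
  fun_prop

lemma contDiff_sway : ContDiff ℝ ∞ (sway (k := k)) := by
  unfold sway
  fun_prop

lemma fderiv_tangentVector {b : Phase (Fin (4 + k)) (Fin 2) → Fin 4 → ℝ} {b' : Fin 4 → ℝ}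
    (hb : DifferentiableAt ℝ b p) (hb' : HasLineDerivAt ℝ b b' p v) :
    fderiv ℝ (fun p => tangentVector k (b p, 0)) p v = tangentVector k (b', 0) := by
  have h : HasFDerivAt (fun p => tangentVector k (b p, 0)) _ p :=
    (tangentVector k).hasFDerivAt.comp p
      (hb.hasFDerivAt.prodMk (hasFDerivAt_const (0 : ℝ × (Fin (k + 1) → ℝ)) p))
  rw [h.fderiv, ← (hb.hasFDerivAt.hasLineDerivAt v).unique hb']
  rfl

lemma fderiv_tangentVector_surge :
    fderiv ℝ (fun p => tangentVector k (surge p, 0)) p v = tangentVector k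
      (![-sin (baseState 4 k _ p 2) * baseState 4 k _ v 2,
        cos (baseState 4 k _ p 2) * baseState 4 k _ v 2, 0, -prolongedJet 4 k 1 v 0], 0) := by
  have hθ := hasDerivAt_pi.1 ((baseState 4 k (Fin 2)).hasFDerivAt.hasLineDerivAt (x := p) v) 2
  have hr := hasDerivAt_pi.1
    ((prolongedJet 4 k (1 : Fin 2)).hasFDerivAt.hasLineDerivAt (x := p) v) 0
  refine fderiv_tangentVector (contDiff_surge.differentiable (by simp) p)
    (hasDerivAt_pi.2 fun i => ?_)
  fin_cases i
  · simpa [surge] using hθ.cos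
  · simpa [surge] using hθ.sin
  · exact hasDerivAt_const _ _
  · exact hr.neg

lemma fderiv_tangentVector_sway (p : Phase (Fin (4 + (k + 1))) (Fin 2)) :
    fderiv ℝ (fun p => tangentVector (k + 1) (sway p, 0)) p
      (tangentVector (k + 1) (0, 0, Pi.single 1 1)) =
      tangentVector (k + 1) (![0, 0, 0, 1], 0) := by
  have hX := hasDerivAt_pi.1 ((baseState 4 (k + 1) (Fin 2)).hasFDerivAt.hasLineDerivAt (x := p)
    (tangentVector (k + 1) (0, 0, Pi.single 1 1))) 2
  have hr := hasDerivAt_pi.1 ((prolongedJet 4 (k + 1) (1 : Fin 2)).hasFDerivAt.hasLineDerivAt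
    (x := p) (tangentVector (k + 1) (0, 0, Pi.single 1 1)))
  rw [baseState_tangentVector] at hX
  rw [prolongedJet_tangentVector] at hr
  refine fderiv_tangentVector (contDiff_sway.differentiable (by simp) p)
    (hasDerivAt_pi.2 fun i => ?_)
  fin_cases i
  · exact (((hr 0).const_mul 2).mul hX.sin).congr_deriv (by simp)
  · exact (((hr 0).const_mul 2).mul hX.cos).neg.congr_deriv (by simp)
  · exact hasDerivAt_const _ _
  · exact ((hr 0).add (hr 1)).congr_deriv (by simp)

lemma append_zero {n l : ℕ} : Fin.append (0 : Fin n → ℝ) (0 : Fin l → ℝ) = 0 := by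
  funext i
  induction i using Fin.addCases <;> simp

lemma snoc_tail_zero : Fin.snoc (α := fun _ => ℝ) (Fin.tail (0 : Fin (k + 1) → ℝ)) 0 = 0 := by
  funext i
  induction i using Fin.lastCases <;> simp [Fin.tail]

lemma snoc_tail_single_succ (i : Fin k) :
    Fin.snoc (α := fun _ => ℝ) (Fin.tail (Pi.single i.succ (1 : ℝ) : Fin (k + 1) → ℝ)) 0 =
      Pi.single i.castSucc 1 := by
  funext l
  induction l using Fin.lastCases <;>
    simp [Fin.tail, Pi.single_apply, (Fin.castSucc_ne_last _).symm]

namespace ControlField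

lemma tangentVector_control : ControlField (shipPr k) 0 fun _ => tangentVector k (0, 1, 0) := by
  have h : (0, 0, ![1, 0]) = tangentVector k (0, 1, 0) :=
    Prod.ext rfl (Prod.ext append_zero.symm rfl)
  exact h ▸ .control ![1, 0]

lemma tangentVector_single (i : Fin (k + 1)) :
    ControlField (shipPr k) (k - i) fun _ => tangentVector k (0, 0, Pi.single i 1) := by
  induction i using Fin.reverseInduction with
  | last =>
    have hinit : Fin.init (Pi.single (Fin.last k) (1 : ℝ) : Fin (k + 1) → ℝ) = 0 :=
      funext fun i => Pi.single_eq_of_ne (Fin.castSucc_ne_last i) 1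
    have h : (0, 0, ![0, 1]) = tangentVector k (0, 0, Pi.single (Fin.last k) 1) := by
      simp [tangentVector, hinit, append_zero]
    rw [Fin.val_last, Nat.sub_self]
    exact h ▸ .control ![0, 1]
  | cast i ih =>
    have hlevel : k - i.castSucc = k - i.succ + 1 := by
      rw [Fin.val_castSucc, Fin.val_succ]; omega
    refine hlevel ▸ ih.ad_const fun p => ?_
    rw [fderiv_totalField_shipPr, snoc_tail_single_succ]
    refine congrArg (fun b => tangentVector k (b, 0, Pi.single i.castSucc 1)) (funext fun l => ?_)
    fin_cases l <;> simp

lemma tangentVector_surge :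
    ControlField (shipPr k) 1 fun p => tangentVector k (surge p, 0) :=
  tangentVector_control.ad_const fun p => by
    rw [fderiv_totalField_shipPr, snoc_tail_zero]
    refine congrArg (fun b => tangentVector k (b, 0)) ?_
    simp [surge]

lemma tangentVector_sway :
    ControlField (shipPr (k + 1)) 2 fun p => tangentVector (k + 1) (sway p, 0) := by
  convert ControlField.ad tangentVector_surge using 2 with p
  have hT : fderiv ℝ (totalField (shipPr (k + 1))) p (tangentVector (k + 1) (surge p, 0)) = _ :=
    fderiv_totalField_shipPr p (surge p) 0 0
  rw [snoc_tail_zero] at hT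
  have hjet : prolongedJet 4 (k + 1) 1 (totalField (shipPr (k + 1)) p) 0 = _ :=
    prolongedJet_totalField p 0
  rw [VectorField.lieBracket, hT, fderiv_tangentVector_surge, baseState_totalField, hjet,
    ← map_sub, Prod.mk_sub_mk, sub_zero]
  refine congrArg (fun b => tangentVector (k + 1) (b, 0)) (funext fun l => ?_)
  fin_cases l <;> simp [surge, sway, ship] <;> ring

lemma tangentVector_yaw :
    ControlField (shipPr 0) 1 fun p => tangentVector 0 (![0, 0, 1, -p.2.2 0], 0) :=
  (tangentVector_single 0).ad_const fun p => by
    have hjet : Fin.snoc (α := fun _ => ℝ) (Fin.tail (Pi.single 0 1 : Fin 1 → ℝ)) 0 = 0 :=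
      funext fun i => by rw [Fin.eq_zero i]; rfl
    rw [fderiv_totalField_shipPr, hjet]
    refine congrArg (fun b => tangentVector 0 (b, 0)) ?_
    simp

lemma tangentVector_slip_of_surge (hm : k ≤ m) (hm' : 1 ≤ m) :
    ControlField (shipPr k) m fun _ => tangentVector k (![0, 0, 0, -1], 0) :=
  ((tangentVector_single 0).mono (by simpa using hm)).bracket_const
    (tangentVector_surge.mono hm') fun p => by
      rw [fderiv_tangentVector_surge, baseState_tangentVector, prolongedJet_tangentVector]
      simp

lemma tangentVector_slip_of_sway (hm : k ≤ m) (hm' : 2 ≤ m) :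
    ControlField (shipPr (k + 1)) m fun _ => tangentVector (k + 1) (![0, 0, 0, 1], 0) :=
  ((tangentVector_single 1).mono (by simpa using hm)).bracket_const
    (tangentVector_sway.mono hm') fderiv_tangentVector_sway

end ControlField

end ShipBrackets

section NotLinearizable

open Real

variable {k m : ℕ}

/-- The vertical directions `∂_{u₁}` and `∂_{v_i}` that are control fields of level at most `m`. -/
def verticalDirection (k m : ℕ) :
    Unit ⊕ {i : Fin (k + 1) // k - i ≤ m} → ℝ × (Fin (k + 1) → ℝ) :=
  Sum.elim (fun _ => (1, 0)) fun i => (0, Pi.single i.1 1)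

lemma linearIndependent_verticalDirection (k m : ℕ) :
    LinearIndependent ℝ (verticalDirection k m) :=
  linearIndependent_inl_union_inr' (LinearIndependent.of_subsingleton () one_ne_zero)
    ((Pi.linearIndependent_single_one (Fin (k + 1)) ℝ).comp _ Subtype.val_injective)

lemma controlField_verticalDirection (r : Unit ⊕ {i : Fin (k + 1) // k - i ≤ m}) :
    ControlField (shipPr k) m fun _ => tangentVector k (0, verticalDirection k m r) := by
  rcases r with _ | i
  · exact ControlField.tangentVector_control.mono m.zero_le
  · exact (ControlField.tangentVector_single i.1).mono i.2

lemma not_staticFeedbackLinearizableAt_shipPr_of_dense {τ : Type*} [Fintype τ]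
    {b : τ → Phase (Fin (4 + k)) (Fin 2) → Fin 4 → ℝ}
    (h : ∀ i, ControlField (shipPr k) m fun p => tangentVector k (b i p, 0))
    (hcard : 2 * (m + 1) < Fintype.card τ + (1 + Fintype.card {i : Fin (k + 1) // k - i ≤ m}))
    (hb : Dense {p | LinearIndependent ℝ fun i => b i p}) (p : Phase (Fin (4 + k)) (Fin 2)) :
    ¬ StaticFeedbackLinearizableAt (shipPr k) p := by
  let V (r : τ ⊕ Unit ⊕ {i : Fin (k + 1) // k - i ≤ m}) (p : Phase (Fin (4 + k)) (Fin 2)) :=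
    tangentVector k (Sum.elim (fun i => (b i p, 0)) (fun r => (0, verticalDirection k m r)) r)
  refine not_staticFeedbackLinearizableAt_of_dense (V := V) (contDiff_totalField_shipPr k)
    (Sum.rec h controlField_verticalDirection) ?_ (hb.mono fun p hp => ?_) p
  · simpa [mul_comm] using hcard
  · exact (linearIndependent_inl_union_inr' hp (linearIndependent_verticalDirection k m)).map'
      (tangentVector k).toLinearMap (LinearMap.ker_eq_bot.2 injective_tangentVector)

lemma eq_zero_of_rotation {θ a b : ℝ} (h₁ : a * cos θ + b * sin θ = 0)
    (h₂ : a * sin θ - b * cos θ = 0) : a = 0 ∧ b = 0 := by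
  have h := sin_sq_add_cos_sq θ
  constructor
  · linear_combination cos θ * h₁ + sin θ * h₂ - a * h
  · linear_combination sin θ * h₁ - cos θ * h₂ - b * h

lemma linearIndependent_surge_slip (p : Phase (Fin (4 + k)) (Fin 2)) :
    LinearIndependent ℝ ![surge p, ![0, 0, 0, -1]] := by
  rw [LinearIndependent.pair_iff]
  intro c d h
  have hx : c * cos (baseState 4 k _ p 2) = 0 := by simpa [surge] using congrFun h 0
  have hy : c * sin (baseState 4 k _ p 2) = 0 := by simpa [surge] using congrFun h 1
  have hz : c * -prolongedJet 4 k 1 p 0 + d * -1 = 0 := congrFun h 3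
  have hc : c = 0 := (eq_zero_of_rotation (b := 0) (by linarith) (by linarith)).1
  exact ⟨hc, by linear_combination -hz - prolongedJet 4 k 1 p 0 * hc⟩

lemma linearIndependent_yaw_surge_slip (p : Phase (Fin (4 + k)) (Fin 2)) :
    LinearIndependent ℝ ![![0, 0, 1, -p.2.2 0], surge p, ![0, 0, 0, -1]] := by
  refine linearIndependent_finCons.2 ⟨linearIndependent_surge_slip p, fun hmem => ?_⟩
  obtain ⟨c, h⟩ := (Submodule.mem_span_range_iff_exists_fun ℝ).1 hmem
  simpa [surge, Fin.sum_univ_two] using congrFun h 2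

lemma linearIndependent_sway_surge_slip {p : Phase (Fin (4 + (k + 1))) (Fin 2)}
    (hp : prolongedJet 4 (k + 1) 1 p 0 ≠ 0) :
    LinearIndependent ℝ ![sway p, surge p, ![0, 0, 0, 1]] := by
  refine Fintype.linearIndependent_iff.2 fun c h => ?_
  set r := prolongedJet 4 (k + 1) 1 p 0
  set θ := baseState 4 (k + 1) _ p 2
  have hx : c 0 * (2 * r * sin θ) + c 1 * cos θ = 0 := by
    simpa [surge, sway, Fin.sum_univ_three] using congrFun h 0
  have hy : -(c 0 * (2 * r * cos θ)) + c 1 * sin θ = 0 := by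
    simpa [surge, sway, Fin.sum_univ_three] using congrFun h 1
  obtain ⟨h1, h0⟩ := eq_zero_of_rotation (θ := θ) (a := c 1) (b := c 0 * (2 * r))
    (by linear_combination hx) (by linear_combination hy)
  have h0 : c 0 = 0 := (mul_eq_zero.1 h0).resolve_right (mul_ne_zero two_ne_zero hp)
  have h2 : c 2 = 0 := by simpa [h0, h1, Fin.sum_univ_three] using congrFun h 3
  exact Fin.forall_fin_succ.2 ⟨h0, Fin.forall_fin_two.2 ⟨h1, h2⟩⟩

lemma dense_prolongedJet_zero_ne_zero (k : ℕ) :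
    Dense {p : Phase (Fin (4 + k)) (Fin 2) | prolongedJet 4 k 1 p 0 ≠ 0} := by
  refine dense_ne_zero_of_finite_line (tangentVector k (0, 0, Pi.single 0 1)) fun p => ?_
  refine (Set.finite_singleton (-prolongedJet 4 k 1 p 0)).subset fun s hs => ?_
  rw [Set.mem_ofPred_eq, map_add, map_smul, prolongedJet_tangentVector] at hs
  exact eq_neg_of_add_eq_zero_right (by simpa using hs)

lemma not_staticFeedbackLinearizableAt_shipPr_zero (p : Phase (Fin (4 + 0)) (Fin 2)) :
    ¬ StaticFeedbackLinearizableAt (shipPr 0) p := by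
  refine not_staticFeedbackLinearizableAt_shipPr_of_dense (m := 1)
    (b := fun i p => ![![0, 0, 1, -p.2.2 0], surge p, ![0, 0, 0, -1]] i)
    (Fin.forall_fin_succ.2 ⟨ControlField.tangentVector_yaw, Fin.forall_fin_two.2
      ⟨ControlField.tangentVector_surge, .tangentVector_slip_of_surge zero_le_one le_rfl⟩⟩)
    (by decide) ?_ p
  simp only [linearIndependent_yaw_surge_slip, Set.ofPred_true, dense_univ]

lemma not_staticFeedbackLinearizableAt_shipPr_one (p : Phase (Fin (4 + 1)) (Fin 2)) :
    ¬ StaticFeedbackLinearizableAt (shipPr 1) p := by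
  refine not_staticFeedbackLinearizableAt_shipPr_of_dense (m := 1)
    (b := fun i p => ![surge p, ![0, 0, 0, -1]] i) (Fin.forall_fin_two.2
      ⟨ControlField.tangentVector_surge, .tangentVector_slip_of_surge le_rfl le_rfl⟩)
    (by decide) ?_ p
  simp only [linearIndependent_surge_slip, Set.ofPred_true, dense_univ]

lemma not_staticFeedbackLinearizableAt_shipPr_succ (hk : 1 ≤ k) (hk' : k ≤ 2)
    (p : Phase (Fin (4 + (k + 1))) (Fin 2)) :
    ¬ StaticFeedbackLinearizableAt (shipPr (k + 1)) p := by
  refine not_staticFeedbackLinearizableAt_shipPr_of_dense (m := 2)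
    (b := fun i p => ![sway p, surge p, ![0, 0, 0, 1]] i)
    (Fin.forall_fin_succ.2 ⟨ControlField.tangentVector_sway, Fin.forall_fin_two.2
      ⟨ControlField.tangentVector_surge.mono one_le_two,
        .tangentVector_slip_of_sway hk' le_rfl⟩⟩)
    (by interval_cases k <;> decide)
    ((dense_prolongedJet_zero_ne_zero (k + 1)).mono fun p => linearIndependent_sway_surge_slip) p

lemma not_staticFeedbackLinearizableAt_shipPr (k : ℕ) (hk : k < 4)
    (p : Phase (Fin (4 + k)) (Fin 2)) : ¬ StaticFeedbackLinearizableAt (shipPr k) p := by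
  match k with
  | 0 => exact not_staticFeedbackLinearizableAt_shipPr_zero p
  | 1 => exact not_staticFeedbackLinearizableAt_shipPr_one p
  | k + 2 => exact not_staticFeedbackLinearizableAt_shipPr_succ (by omega) (by omega) p

end NotLinearizable

section FlatOutput

variable {n k r : ℕ} {μ : Type} {j : μ}

/-- A jet `(t, x, u, …, u^(r))` of a control system agrees with a point of its `k`-fold
prolongation in the direction of `u_j` in the coordinates that both have in common. -/
structure LiesOver (hr : r ≤ k) (j : μ) (p : Phase (Fin (n + k)) μ)
    (q : ControlJet (Fin n) μ r) : Prop where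
  time : q.1 = p.1
  state : q.2.1 = baseState n k μ p
  controlJet : ∀ i, q.2.2 i j = prolongedJet n k j p (i.castLE (Nat.succ_le_succ hr))

variable [Fintype μ] [DecidableEq μ] {S : ControlSystem (Fin n) μ} {I : Set ℝ} {t : ℝ}

lemma IsTrajectory.liesOver_prolongPoint {x : ℝ → Fin n → ℝ} {u : ℝ → μ → ℝ}
    (h : IsTrajectory S I x u) (hI : IsOpen I) (ht : t ∈ I) (hr : r ≤ k) (j : μ) :
    LiesOver hr j (prolongPoint k j x u t) (t, x t, jet r u t) where
  time := rfl
  state := (baseState_prolongPoint x u).symm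
  controlJet i := by
    rw [prolongedJet_prolongPoint]
    exact iteratedDeriv_apply hI h.smooth_control i j ht

lemma IsTrajectory.liesOver_project {X : ℝ → Fin (n + k) → ℝ} {v : ℝ → μ → ℝ}
    (h : IsTrajectory (prolongIter S j k) I X v) (hI : IsOpen I) (ht : t ∈ I) (hr : r ≤ k) :
    LiesOver hr j (t, X t, v t)
      (t, baseState n k μ (t, X t, v t), jet r (fun τ => baseControl n k j (τ, X τ, v τ)) t) where
  time := rfl
  state := rfl
  controlJet i := by
    rw [h.prolongedJet_eq_iteratedDeriv hI ht]
    refine (iteratedDeriv_apply hI h.project_prolongIter.smooth_control i j ht).trans ?_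
    simp only [baseControl, Function.update_self, Fin.val_castLE]

variable {μ' : Type} [Fintype μ'] {κ : μ' → ℕ} {s : ℕ}
  {Φ : OpenPartialHomeomorph (Phase (Fin (n + k)) μ) (Phase (Σ j, Fin (κ j)) μ')}

/-- The states and controls of a system as a function of the jet of a flat output, when `Φ` puts its
`k`-fold prolongation in the direction of `u_j` into Brunovsky normal form. -/
def ofOutputJet (j : μ) (hs : ∀ j, κ j ≤ s) (e : μ ≃ μ')
    (Φ : OpenPartialHomeomorph (Phase (Fin (n + k)) μ) (Phase (Σ j, Fin (κ j)) μ'))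
    (Y : ℝ × (Fin (s + 1) → μ → ℝ)) : (Fin n → ℝ) × (μ → ℝ) :=
  (baseState n k μ (Φ.symm (jetPoint κ hs e Y)), baseControl n k j (Φ.symm (jetPoint κ hs e Y)))

lemma contDiffOn_ofOutputJet (hΦ : IsStaticFeedback (prolongIter S j k) (brunovsky κ) Φ)
    (hs : ∀ j, κ j ≤ s) (e : μ ≃ μ') :
    ContDiffOn ℝ ∞ (ofOutputJet j hs e Φ) (jetPoint κ hs e ⁻¹' Φ.target) :=
  ((baseState n k μ).contDiff.prodMk (contDiff_baseControl n k j)).comp_contDiffOn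
    (hΦ.smooth_symm.comp (contDiff_jetPoint hs e).contDiffOn fun _ hY => hY)

lemma IsTrajectory.ofOutputJet_eq (hΦ : IsStaticFeedback (prolongIter S j k) (brunovsky κ) Φ)
    {x : ℝ → Fin n → ℝ} {u : ℝ → μ → ℝ} (h : IsTrajectory S I x u) (hI : IsOpen I)
    (hsource : ∀ t ∈ I, prolongPoint k j x u t ∈ Φ.source) (hs : ∀ j, κ j ≤ s) (e : μ ≃ μ')
    {y : ℝ → μ → ℝ}
    (hy : ∀ t ∈ I, ∀ i, y t i = chainJet κ (e i) (Φ (prolongPoint k j x u t)) 0) (ht : t ∈ I) :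
    jetPoint κ hs e (t, jet s y t) ∈ Φ.target ∧
      ofOutputJet j hs e Φ (t, jet s y t) = (x t, u t) := by
  have hpoint (t) (ht : t ∈ I) : (t, (Φ (prolongPoint k j x u t)).2) =
      Φ (prolongPoint k j x u t) := Prod.ext (hΦ.apply_fst (hsource t ht)).symm rfl
  have hjet : jetPoint κ hs e (t, jet s y t) = Φ (prolongPoint k j x u t) := by
    refine (((h.lift_prolongIter hI j k).map_isStaticFeedback hI hΦ hsource).jetPoint_eq hI hs e
      (fun t ht i => ?_) ht).trans (hpoint t ht)
    exact (hy t ht i).trans (congrArg (fun p => chainJet κ (e i) p 0) (hpoint t ht).symm)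
  rw [ofOutputJet, hjet, Φ.left_inv (hsource t ht), baseState_prolongPoint,
    baseControl_prolongPoint]
  exact ⟨Φ.map_source (hsource t ht), rfl⟩

lemma IsTrajectory.of_outputJet (hΦ : IsStaticFeedback (prolongIter S j k) (brunovsky κ) Φ)
    (hr : r ≤ k) (hs : ∀ j, κ j ≤ s) (e : μ ≃ μ') {y : ℝ → μ → ℝ} (hI : IsOpen I)
    (hy : ContDiffOn ℝ ∞ y I) (htarget : ∀ t ∈ I, jetPoint κ hs e (t, jet s y t) ∈ Φ.target) :
    IsTrajectory S I (fun t => (ofOutputJet j hs e Φ (t, jet s y t)).1)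
        (fun t => (ofOutputJet j hs e Φ (t, jet s y t)).2) ∧
      ∀ t ∈ I, LiesOver hr j (Φ.symm (jetPoint κ hs e (t, jet s y t)))
        (t, (ofOutputJet j hs e Φ (t, jet s y t)).1,
          jet r (fun τ => (ofOutputJet j hs e Φ (τ, jet s y τ)).2) t) := by
  have htraj := (isTrajectory_jetPoint hs e hI hy).map_isStaticFeedback_symm hI hΦ htarget
  have hcontrol (t : ℝ) : (ofOutputJet j hs e Φ (t, jet s y t)).2 =
      baseControl n k j (t, (Φ.symm (jetPoint κ hs e (t, jet s y t))).2) :=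
    baseControl_congr rfl
  simp only [hcontrol]
  refine ⟨htraj.project_prolongIter, fun t ht => ?_⟩
  have htime : (Φ.symm (jetPoint κ hs e (t, jet s y t))).1 = t := by
    rw [← hΦ.apply_fst (Φ.map_target (htarget t ht)), Φ.right_inv (htarget t ht)]
    rfl
  have hover := htraj.liesOver_project hI ht hr
  exact ⟨htime.symm, hover.state, fun i => (hover.controlJet i).trans
    (congrFun (prolongedJet_congr (by rfl)) _)⟩

lemma isFlatOutputOn_of_isStaticFeedback
    (hΦ : IsStaticFeedback (prolongIter S j k) (brunovsky κ) Φ) (hr : r ≤ k) (e : μ ≃ μ')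
    {Ω : Set (ControlJet (Fin n) μ r)} {h : ControlJet (Fin n) μ r → μ → ℝ} (hΩ : IsOpen Ω)
    (hh : ContDiffOn ℝ ∞ h Ω)
    (hsource : ∀ p q, LiesOver hr j p q → (q ∈ Ω ↔ p ∈ Φ.source))
    (houtput : ∀ p q, LiesOver hr j p q → p ∈ Φ.source → ∀ i, h q i = chainJet κ (e i) (Φ p) 0) :
    IsFlatOutputOn S r Ω h := by
  have hs (j) : κ j ≤ Finset.univ.sup κ := Finset.le_sup (Finset.mem_univ j)
  refine ⟨hΩ, hh, Finset.univ.sup κ, jetPoint κ hs e ⁻¹' Φ.target, ofOutputJet j hs e Φ,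
    Φ.open_target.preimage (contDiff_jetPoint hs e).continuous, contDiffOn_ofOutputJet hΦ hs e,
    fun c d x u htraj hmem t ht => ?_, fun c d y hy hmem => ?_⟩
  · have hover (t) (ht : t ∈ Set.Ioo c d) := htraj.liesOver_prolongPoint isOpen_Ioo ht hr j
    have hpoint (t) (ht : t ∈ Set.Ioo c d) := (hsource _ _ (hover t ht)).1 (hmem t ht)
    exact htraj.ofOutputJet_eq hΦ isOpen_Ioo hpoint hs e
      (fun t ht => houtput _ _ (hover t ht) (hpoint t ht)) ht
  · obtain ⟨htraj, hover⟩ := IsTrajectory.of_outputJet hΦ hr hs e isOpen_Ioo hy hmem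
    refine ⟨htraj, fun t ht => ⟨(hsource _ _ (hover t ht)).2 (Φ.map_target (hmem t ht)), ?_⟩⟩
    funext i
    rw [houtput _ _ (hover t ht) (Φ.map_target (hmem t ht)), Φ.right_inv (hmem t ht),
      chainJet_jetPoint, e.symm_apply_apply]
    simp only [jet, Fin.val_castLE, Fin.val_zero, iteratedDeriv_zero]

end FlatOutput

section Determinant

variable {E : Type*} [NormedAddCommGroup E] [NormedSpace ℝ E] {m : Type*} [Fintype m]
  [DecidableEq m] {U : Set E} {A : E → Matrix m m ℝ}

lemma contDiffOn_det (hA : ∀ i j, ContDiffOn ℝ ∞ (fun x => A x i j) U) :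
    ContDiffOn ℝ ∞ (fun x => (A x).det) U := by
  simp only [Matrix.det_apply']
  exact ContDiffOn.sum fun σ _ =>
    contDiffOn_const.mul (contDiffOn_prod fun i _ => hA (σ i) i)

lemma contDiffOn_inv_mulVec {v : E → m → ℝ} (hA : ∀ i j, ContDiffOn ℝ ∞ (fun x => A x i j) U)
    (hv : ContDiffOn ℝ ∞ v U) (hdet : ∀ x ∈ U, (A x).det ≠ 0) :
    ContDiffOn ℝ ∞ (fun x => (A x)⁻¹.mulVec (v x)) U := by
  refine contDiffOn_pi.2 fun i => ?_
  have hcramer : ContDiffOn ℝ ∞ (fun x => ((A x).updateCol i (v x)).det) U :=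
    contDiffOn_det fun k l => by
      rcases eq_or_ne l i with rfl | hl
      · simpa only [Matrix.updateCol_self] using contDiffOn_pi.1 hv k
      · simpa only [Matrix.updateCol_ne hl] using hA k l
  refine (((contDiffOn_det hA).inv hdet).mul hcramer).congr fun x hx => ?_
  rw [← Matrix.cramer_apply, ← Matrix.det_smul_inv_mulVec_eq_cramer _ _ (hdet x hx).isUnit,
    Pi.smul_apply, smul_eq_mul, Pi.inv_apply, inv_mul_cancel_left₀ (hdet x hx)]

end Determinant

section ContactMap

variable {ι μ : Type} [Fintype ι] [Fintype μ] {S : ControlSystem ι μ}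

lemma iterate_totalDeriv {N : ℕ} {g : Fin (N + 1) → Phase ι μ → ℝ}
    (hg : ∀ i : Fin N, totalDeriv S (g i.castSucc) = g i.succ) (i : Fin (N + 1)) :
    (totalDeriv S)^[i] (g 0) = g i := by
  induction i using Fin.induction with
  | zero => rfl
  | succ i ih => rw [Fin.val_succ, Function.iterate_succ_apply', ← hg, ← ih, Fin.val_castSucc]

lemma chainJet_contactMap {k : ℕ} {ρ : Fin k → ℕ} (h : SigIndex ρ → Phase ι μ → ℝ)
    (j : SigIndex ρ) (p : Phase ι μ) (i : Fin (sigOrder ρ j + 1)) :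
    chainJet (sigOrder ρ) j (contactMap S ρ h p) i = (totalDeriv S)^[i] (h j) p := by
  induction i using Fin.lastCases with
  | last => rw [chainJet_last]; rfl
  | cast i => rw [chainJet_castSucc]; rfl

end ContactMap

section OutputJet

open Real

/-- The coefficients that express the derivatives of `a` up to order three in terms of
the body coordinates, as functions of `s = (u₂, v₁, v₂, v₃, v₄)`. Each row comes from the previous
one by the product rule and the equations of motion in the rotating frame. -/
def outputMatrix (s : Fin 5 → ℝ) : Matrix (Fin 4) (Fin 4) ℝ :=
  !![s 0 + s 1, 2 * s 0, 0, 0;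
    2 * s 0 ^ 3 + s 1 + s 2, 3 * s 1 - s 0, 0, 0;
    9 * s 0 ^ 2 * s 1 + s 2 + s 3 - s 0 ^ 3, 4 * s 2 - 3 * s 1 + 2 * s 0 ^ 3 + s 0,
      -ell (s 0) (s 1) (s 2), 0;
    21 * s 0 * s 1 ^ 2 + 11 * s 0 ^ 2 * s 2 + s 3 + s 4 - 6 * s 0 ^ 2 * s 1 - 2 * s 0 ^ 5,
      5 * s 3 - 6 * s 2 + 15 * s 0 ^ 2 * s 1 + 4 * s 1 - 3 * s 0 ^ 3 - s 0,
      -(2 * s 0 * s 1 + 16 * s 0 ^ 3 * s 1 - 4 * s 1 * s 2 + 2 * s 0 * s 3) -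
        2 * s 0 * (9 * s 0 ^ 2 * s 1 + s 2 + s 3 - s 0 ^ 3) +
        (s 0 + s 1) * (4 * s 2 - 3 * s 1 + 2 * s 0 ^ 3 + s 0),
      -ell (s 0) (s 1) (s 2)]

lemma det_outputMatrix (s : Fin 5 → ℝ) :
    (outputMatrix s).det = -ell (s 0) (s 1) (s 2) ^ 3 := by
  have hblock : (outputMatrix s).det =
      ((s 0 + s 1) * (3 * s 1 - s 0) - 2 * s 0 * (2 * s 0 ^ 3 + s 1 + s 2)) *
        ell (s 0) (s 1) (s 2) ^ 2 := by
    have hlast : Fin.succAbove (3 : Fin 4) = ![0, 1, 2] := by decide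
    rw [Matrix.det_succ_column _ 3, Fin.sum_univ_four]
    simp only [outputMatrix, Matrix.det_fin_three, hlast, Matrix.submatrix_apply, Matrix.of_apply,
      Matrix.cons_val, mul_zero, zero_mul, zero_add, Fin.coe_ofNat_eq_mod]
    ring
  have hminor : (s 0 + s 1) * (3 * s 1 - s 0) - 2 * s 0 * (2 * s 0 ^ 3 + s 1 + s 2) =
      -ell (s 0) (s 1) (s 2) := by
    simp only [ell]
    ring
  rw [hblock, hminor]
  ring

lemma outputMatrix_mulVec (s : Fin 5 → ℝ) (b : Fin 4 → ℝ) :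
    (outputMatrix s).mulVec b =
      ![(s 0 + s 1) * b 0 + 2 * s 0 * b 1,
        (2 * s 0 ^ 3 + s 1 + s 2) * b 0 + (3 * s 1 - s 0) * b 1,
        (9 * s 0 ^ 2 * s 1 + s 2 + s 3 - s 0 ^ 3) * b 0 +
          (4 * s 2 - 3 * s 1 + 2 * s 0 ^ 3 + s 0) * b 1 - ell (s 0) (s 1) (s 2) * b 2,
        outputMatrix s 3 0 * b 0 + outputMatrix s 3 1 * b 1 + outputMatrix s 3 2 * b 2 -
          ell (s 0) (s 1) (s 2) * b 3] := by
  funext i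
  rw [Matrix.mulVec, dotProduct, Fin.sum_univ_four]
  fin_cases i <;> simp [outputMatrix] <;> ring

lemma hasDerivAt_outputMatrix_mulVec {s : ℝ → Fin 5 → ℝ} {b : ℝ → Fin 4 → ℝ} {t : ℝ}
    (hs : ∀ i : Fin 4, HasDerivAt (fun τ => s τ i.castSucc) (s t i.succ) t)
    (hb₀ : HasDerivAt (fun τ => b τ 0) (b t 1 - 2 * s t 0 * b t 2) t)
    (hb₁ : HasDerivAt (fun τ => b τ 1)
      (s t 0 ^ 2 * b t 0 - b t 1 + (s t 0 + s t 1) * b t 2) t)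
    (hb₂ : HasDerivAt (fun τ => b τ 2) (s t 0 * b t 0 + b t 3) t) (i : Fin 3) :
    HasDerivAt (fun τ => (outputMatrix (s τ)).mulVec (b τ) i.castSucc)
      ((outputMatrix (s t)).mulVec (b t) i.succ) t := by
  have h₀ : HasDerivAt (fun τ => s τ 0) (s t 1) t := hs 0
  have h₁ : HasDerivAt (fun τ => s τ 1) (s t 2) t := hs 1
  have h₂ : HasDerivAt (fun τ => s τ 2) (s t 3) t := hs 2
  have h₃ : HasDerivAt (fun τ => s τ 3) (s t 4) t := hs 3
  have hℓ : HasDerivAt (fun τ => ell (s τ 0) (s τ 1) (s τ 2)) (2 * s t 0 * s t 1 +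
      16 * s t 0 ^ 3 * s t 1 - 4 * s t 1 * s t 2 + 2 * s t 0 * s t 3) t :=
    ((((h₀.pow 2).add ((h₀.pow 4).const_mul 4)).add ((h₀.const_mul 2).mul h₂)).sub
      ((h₁.pow 2).const_mul 3)).congr_deriv (by norm_num; ring)
  simp only [outputMatrix_mulVec]
  fin_cases i
  · refine (((h₀.add h₁).mul hb₀).add ((h₀.const_mul 2).mul hb₁)).congr_deriv ?_
    dsimp
    ring
  · refine ((((((h₀.pow 3).const_mul 2).add h₁).add h₂).mul hb₀).add
      (((h₁.const_mul 3).sub h₀).mul hb₁)).congr_deriv ?_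
    dsimp [ell]
    ring
  · refine (((((((((h₀.pow 2).const_mul 9).mul h₁).add h₂).add h₃).sub (h₀.pow 3)).mul hb₀).add
      (((((h₂.const_mul 4).sub (h₁.const_mul 3)).add ((h₀.pow 3).const_mul 2)).add h₀).mul
        hb₁)).sub (hℓ.mul hb₂)).congr_deriv ?_
    simp only [outputMatrix, ell, Matrix.of_apply, Matrix.cons_val, Pi.add_apply, Pi.sub_apply,
      Pi.mul_apply, Pi.pow_apply, Fin.reduceFinMk, Fin.reduceSucc, Nat.cast_ofNat,
      Nat.add_one_sub_one, pow_one]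
    ring

end OutputJet

section Line

lemma hasDerivAt_line {𝕜 E F : Type*} [NontriviallyNormedField 𝕜] [NormedAddCommGroup E]
    [NormedSpace 𝕜 E] [NormedAddCommGroup F] [NormedSpace 𝕜 F] (L : E →L[𝕜] F) (p v : E) :
    HasDerivAt (fun τ : 𝕜 => L (p + τ • v)) (L v) 0 :=
  L.hasFDerivAt.hasLineDerivAt _

lemma totalDeriv_eq_of_hasDerivAt_line {ι μ : Type} [Fintype ι] [Fintype μ]
    {S : ControlSystem ι μ} {p : Phase ι μ} {f : Phase ι μ → ℝ} {c : ℝ} (hf : ContDiff ℝ ∞ f)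
    (h : HasDerivAt (fun τ : ℝ => f (p + τ • totalField S p)) c 0) : totalDeriv S f p = c :=
  ((hf.differentiable (by simp) p).hasFDerivAt.hasLineDerivAt _).unique h

end Line

section BodyCoordinates

open Real

/-- The coordinates of the ship in its rotating frame: `y cos θ - x sin θ`, the combination
`z + u₂ (x cos θ + y sin θ)`, `x cos θ + y sin θ`, and the control `u₁`. In this order the jet of
`a` is given by a block triangular matrix. -/
def bodyState (p : Phase (Fin (4 + 4)) (Fin 2)) : Fin 4 → ℝ :=
  let X := baseState 4 4 (Fin 2) p
  ![X 1 * cos (X 2) - X 0 * sin (X 2),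
    X 3 + prolongedJet 4 4 1 p 0 * (X 0 * cos (X 2) + X 1 * sin (X 2)),
    X 0 * cos (X 2) + X 1 * sin (X 2),
    p.2.2 0]

/-- The functions `a, T a, T² a, T³ a` on the four-fold prolongation. -/
def outputJet (p : Phase (Fin (4 + 4)) (Fin 2)) : Fin 4 → ℝ :=
  (outputMatrix (prolongedJet 4 4 1 p)).mulVec (bodyState p)

/-- The functions `θ, T θ, …, T⁵ θ` on the four-fold prolongation. -/
def yawJet (p : Phase (Fin (4 + 4)) (Fin 2)) : Fin 6 → ℝ :=
  Fin.cons (baseState 4 4 (Fin 2) p 2) (prolongedJet 4 4 1 p)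

lemma contDiff_outputMatrix (i j : Fin 4) : ContDiff ℝ ∞ fun s => outputMatrix s i j := by
  simp only [outputMatrix, ell, Matrix.of_apply]
  fun_prop

lemma contDiff_bodyState : ContDiff ℝ ∞ bodyState := by
  unfold bodyState
  fun_prop

lemma contDiff_outputJet : ContDiff ℝ ∞ outputJet :=
  contDiff_pi.2 fun i => ContDiff.sum (s := Finset.univ) fun j _ =>
    ((contDiff_outputMatrix i j).comp (prolongedJet 4 4 1).contDiff).mul
      (contDiff_pi.1 contDiff_bodyState j)

lemma contDiff_yawJet : ContDiff ℝ ∞ yawJet := by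
  refine contDiff_pi.2 fun i => ?_
  induction i using Fin.cases <;> simp only [yawJet, Fin.cons_zero, Fin.cons_succ] <;> fun_prop

lemma hasDerivAt_bodyState (p : Phase (Fin (4 + 4)) (Fin 2)) :
    let γ := fun τ : ℝ => p + τ • totalField (shipPr 4) p
    let s := prolongedJet 4 4 1 p
    let b := bodyState p
    HasDerivAt (fun τ => bodyState (γ τ) 0) (b 1 - 2 * s 0 * b 2) 0 ∧
    HasDerivAt (fun τ => bodyState (γ τ) 1) (s 0 ^ 2 * b 0 - b 1 + (s 0 + s 1) * b 2) 0 ∧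
    HasDerivAt (fun τ => bodyState (γ τ) 2) (s 0 * b 0 + b 3) 0 := by
  intro γ s b
  have hX := hasDerivAt_pi.1 (hasDerivAt_line (baseState 4 4 (Fin 2)) p (totalField (shipPr 4) p))
  have hs := hasDerivAt_pi.1 (hasDerivAt_line (prolongedJet 4 4 1) p (totalField (shipPr 4) p)) 0
  have hs0 := prolongedJet_totalField p 0
  rw [baseState_totalField] at hX
  rw [← Fin.castSucc_zero, hs0] at hs
  have htrig := Real.sin_sq_add_cos_sq (baseState 4 4 (Fin 2) p 2)
  refine ⟨?_, ?_, ?_⟩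
  · refine (((hX 1).mul (hX 2).cos).sub ((hX 0).mul (hX 2).sin)).congr_deriv ?_
    simp only [b, s, bodyState, ship, Matrix.cons_val, zero_smul, add_zero]
    linear_combination baseState 4 4 (Fin 2) p 3 * htrig
  · refine ((hX 3).add (hs.mul
      (((hX 0).mul (hX 2).cos).add ((hX 1).mul (hX 2).sin)))).congr_deriv ?_
    simp only [b, s, bodyState, ship, Matrix.cons_val, map_add, map_smul, Pi.add_apply,
      Pi.mul_apply, Pi.zero_apply, zero_smul, add_zero, Fin.castSucc_zero, Fin.succ_zero_eq_one]
    linear_combination p.2.2 0 * prolongedJet 4 4 1 p 0 * htrig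
  · refine (((hX 0).mul (hX 2).cos).add ((hX 1).mul (hX 2).sin)).congr_deriv ?_
    simp only [b, s, bodyState, ship, Matrix.cons_val, zero_smul, add_zero]
    linear_combination p.2.2 0 * htrig

lemma totalDeriv_outputJet (i : Fin 3) :
    totalDeriv (shipPr 4) (fun p => outputJet p i.castSucc) = fun p => outputJet p i.succ := by
  funext p
  refine totalDeriv_eq_of_hasDerivAt_line (contDiff_pi.1 contDiff_outputJet _) ?_
  obtain ⟨hb₀, hb₁, hb₂⟩ := hasDerivAt_bodyState p
  have hs (i : Fin 4) := hasDerivAt_pi.1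
    (hasDerivAt_line (prolongedJet 4 4 1) p (totalField (shipPr 4) p)) i.castSucc
  simp only [prolongedJet_totalField] at hs
  have h := hasDerivAt_outputMatrix_mulVec (t := 0)
    (s := fun τ => prolongedJet 4 4 1 (p + τ • totalField (shipPr 4) p))
    (b := fun τ => bodyState (p + τ • totalField (shipPr 4) p)) (i := i)
  simp only [zero_smul, add_zero] at h
  exact h hs hb₀ hb₁ hb₂

lemma totalDeriv_yawJet (i : Fin 5) :
    totalDeriv (shipPr 4) (fun p => yawJet p i.castSucc) = fun p => yawJet p i.succ := by
  funext p
  refine totalDeriv_eq_of_hasDerivAt_line (contDiff_pi.1 contDiff_yawJet _) ?_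
  induction i using Fin.cases with
  | zero =>
    have h := hasDerivAt_pi.1
      (hasDerivAt_line (baseState 4 4 (Fin 2)) p (totalField (shipPr 4) p)) 2
    rwa [baseState_totalField] at h
  | succ i =>
    have h := hasDerivAt_pi.1
      (hasDerivAt_line (prolongedJet 4 4 1) p (totalField (shipPr 4) p)) i.castSucc
    rwa [prolongedJet_totalField] at h

lemma outputJet_castSucc_congr {p q : Phase (Fin (4 + 4)) (Fin 2)} (h : p.2.1 = q.2.1)
    (i : Fin 3) : outputJet p i.castSucc = outputJet q i.castSucc := by
  have h₀ : prolongedJet 4 4 1 p 0 = prolongedJet 4 4 1 q 0 := prolongedJet_castSucc_congr h 0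
  have h₁ : prolongedJet 4 4 1 p 1 = prolongedJet 4 4 1 q 1 := prolongedJet_castSucc_congr h 1
  have h₂ : prolongedJet 4 4 1 p 2 = prolongedJet 4 4 1 q 2 := prolongedJet_castSucc_congr h 2
  have h₃ : prolongedJet 4 4 1 p 3 = prolongedJet 4 4 1 q 3 := prolongedJet_castSucc_congr h 3
  rw [outputJet, outputJet, outputMatrix_mulVec, outputMatrix_mulVec]
  fin_cases i <;> simp [bodyState, baseState_congr h, h₀, h₁, h₂, h₃]

lemma yawJet_castSucc_congr {p q : Phase (Fin (4 + 4)) (Fin 2)} (h : p.2.1 = q.2.1)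
    (i : Fin 5) : yawJet p i.castSucc = yawJet q i.castSucc := by
  induction i using Fin.cases with
  | zero => exact congrFun (baseState_congr h) 2
  | succ i => exact prolongedJet_castSucc_congr h i

/-- The point of the four-fold prolongation with time `t`, heading `θ`, body coordinates `b` and
jet `s` of `u₂`. -/
def ofBody (t θ : ℝ) (b : Fin 4 → ℝ) (s : Fin 5 → ℝ) : Phase (Fin (4 + 4)) (Fin 2) :=
  (t, (tangentVector 4 (![b 2 * cos θ - b 0 * sin θ, b 2 * sin θ + b 0 * cos θ, θ,
    b 1 - s 0 * b 2], b 3, s)).2)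

lemma baseState_ofBody (t θ : ℝ) (b : Fin 4 → ℝ) (s : Fin 5 → ℝ) :
    baseState 4 4 (Fin 2) (ofBody t θ b s) =
      ![b 2 * cos θ - b 0 * sin θ, b 2 * sin θ + b 0 * cos θ, θ, b 1 - s 0 * b 2] :=
  baseState_tangentVector _ (b 3, s)

lemma prolongedJet_ofBody (t θ : ℝ) (b : Fin 4 → ℝ) (s : Fin 5 → ℝ) :
    prolongedJet 4 4 1 (ofBody t θ b s) = s :=
  (prolongedJet_congr (by rfl)).trans (prolongedJet_tangentVector
    ![b 2 * cos θ - b 0 * sin θ, b 2 * sin θ + b 0 * cos θ, θ, b 1 - s 0 * b 2] (b 3) s)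

lemma bodyState_ofBody (t θ : ℝ) (b : Fin 4 → ℝ) (s : Fin 5 → ℝ) :
    bodyState (ofBody t θ b s) = b := by
  have htrig := sin_sq_add_cos_sq θ
  rw [bodyState, baseState_ofBody, prolongedJet_ofBody]
  funext i
  fin_cases i
  · simp only [Fin.zero_eta, Matrix.cons_val]
    linear_combination b 0 * htrig
  · simp only [Fin.mk_one, Matrix.cons_val]
    linear_combination s 0 * b 2 * htrig
  · simp only [Fin.reduceFinMk, Matrix.cons_val]
    linear_combination b 2 * htrig
  · rfl

lemma ofBody_bodyState (p : Phase (Fin (4 + 4)) (Fin 2)) :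
    ofBody p.1 (baseState 4 4 (Fin 2) p 2) (bodyState p) (prolongedJet 4 4 1 p) = p := by
  have htrig := sin_sq_add_cos_sq (baseState 4 4 (Fin 2) p 2)
  refine ext_baseState_prolongedJet rfl ?_ (prolongedJet_ofBody _ _ _ _) (fun i hi => ?_)
  · rw [baseState_ofBody]
    funext i
    fin_cases i
    · simp only [bodyState, Fin.zero_eta, Matrix.cons_val]
      linear_combination baseState 4 4 (Fin 2) p 0 * htrig
    · simp only [bodyState, Fin.mk_one, Matrix.cons_val]
      linear_combination baseState 4 4 (Fin 2) p 1 * htrig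
    · rfl
    · simp [bodyState]
  · obtain rfl : i = 0 := by omega
    rfl

lemma contDiff_ofBody : ContDiff ℝ ∞ fun q : ℝ × ℝ × (Fin 4 → ℝ) × (Fin 5 → ℝ) =>
    ofBody q.1 q.2.1 q.2.2.1 q.2.2.2 := by
  unfold ofBody
  exact contDiff_fst.prodMk ((tangentVector 4).contDiff.comp (by fun_prop)).snd

end BodyCoordinates

section ShipNormalForm

open Real

/-- The dependent variable of order three. -/
def idxA : SigIndex shipSig := ⟨2, ⟨0, by decide⟩⟩

/-- The dependent variable of order five. -/
def idxTheta : SigIndex shipSig := ⟨4, ⟨0, by decide⟩⟩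

lemma forall_sigIndex_shipSig {P : SigIndex shipSig → Prop} :
    (∀ j, P j) ↔ P idxA ∧ P idxTheta := by
  refine ⟨fun h => ⟨h _, h _⟩, fun ⟨hA, hθ⟩ ⟨l, i⟩ => ?_⟩
  fin_cases l
  · exact i.elim0
  · exact i.elim0
  · rwa [Subsingleton.elim (α := Fin 1) i 0]
  · exact i.elim0
  · rwa [Subsingleton.elim (α := Fin 1) i 0]

lemma shipOutputs_idxA : shipOutputs idxA = fun p => outputJet p 0 := by
  funext p
  rw [outputJet, outputMatrix_mulVec]
  change outputA (baseState 4 4 _ p 0) (baseState 4 4 _ p 1) (baseState 4 4 _ p 2)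
    (baseState 4 4 _ p 3) (prolongedJet 4 4 1 p 0) (prolongedJet 4 4 1 p 1) = _
  simp only [outputA, bodyState, Matrix.cons_val]
  ring

lemma shipOutputs_idxTheta : shipOutputs idxTheta = fun p => yawJet p 0 := rfl

/-- The contact map of the ship. -/
abbrev shipMap : Phase (Fin (4 + 4)) (Fin 2) → Phase (SigState shipSig) (SigIndex shipSig) :=
  contactMap (shipPr 4) shipSig shipOutputs

/-- The chain of length three, of the dependent variable `a`. -/
def outputChain : Phase (SigState shipSig) (SigIndex shipSig) →L[ℝ] (Fin 4 → ℝ) :=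
  chainJet (sigOrder shipSig) idxA

/-- The chain of length five, of the dependent variable `θ`. -/
def yawChain : Phase (SigState shipSig) (SigIndex shipSig) →L[ℝ] (Fin 6 → ℝ) :=
  chainJet (sigOrder shipSig) idxTheta

lemma outputChain_shipMap (p : Phase (Fin (4 + 4)) (Fin 2)) :
    outputChain (shipMap p) = outputJet p := by
  funext i
  refine (chainJet_contactMap shipOutputs idxA p i).trans ?_
  rw [shipOutputs_idxA]
  exact congrFun (iterate_totalDeriv (g := fun i p => outputJet p i) totalDeriv_outputJet i) p

lemma yawChain_shipMap (p : Phase (Fin (4 + 4)) (Fin 2)) : yawChain (shipMap p) = yawJet p := by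
  funext i
  refine (chainJet_contactMap shipOutputs idxTheta p i).trans ?_
  rw [shipOutputs_idxTheta]
  exact congrFun (iterate_totalDeriv (g := fun i p => yawJet p i) totalDeriv_yawJet i) p

lemma contDiff_shipMap : ContDiff ℝ ∞ shipMap := by
  have houtput : ContDiff ℝ ∞ fun p => outputChain (shipMap p) := by
    simpa only [outputChain_shipMap] using contDiff_outputJet
  have hyaw : ContDiff ℝ ∞ fun p => yawChain (shipMap p) := by
    simpa only [yawChain_shipMap] using contDiff_yawJet
  exact contDiff_of_chainJet contDiff_fst (forall_sigIndex_shipSig.2 ⟨houtput, hyaw⟩)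

/-- The inverse of `shipMap`: the jet of `θ` determines the matrix that has to be inverted in order
to recover the body coordinates from the jet of `a`. -/
def shipInv (w : Phase (SigState shipSig) (SigIndex shipSig)) : Phase (Fin (4 + 4)) (Fin 2) :=
  ofBody w.1 (yawChain w 0)
    ((outputMatrix (Fin.tail (yawChain w)))⁻¹.mulVec (outputChain w)) (Fin.tail (yawChain w))

/-- The points of the normal form at which the image of `ℓ` does not vanish. -/
def regularTarget : Set (Phase (SigState shipSig) (SigIndex shipSig)) :=
  {w | (outputMatrix (Fin.tail (yawChain w))).det ≠ 0}

lemma mem_regularSet_iff {p : Phase (Fin (4 + 4)) (Fin 2)} :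
    p ∈ regularSet ↔ (outputMatrix (prolongedJet 4 4 1 p)).det ≠ 0 := by
  rw [det_outputMatrix, neg_ne_zero, pow_ne_zero_iff three_ne_zero]
  rfl

lemma isOpen_regularSet : IsOpen regularSet := by
  unfold regularSet ell
  exact isOpen_ne_fun (by fun_prop) continuous_const

lemma dense_regularSet : Dense regularSet :=
  dense_ne_zero_of_finite_line (0, Pi.single 4 1, 0) fun p => by
    simpa using (finite_setOf_ell_eq_zero (p.2.1 5) (p.2.1 6)).preimage
      (add_right_injective (p.2.1 4)).injOn

lemma shipMap_mem_regularTarget_iff {p : Phase (Fin (4 + 4)) (Fin 2)} :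
    shipMap p ∈ regularTarget ↔ p ∈ regularSet := by
  rw [mem_regularSet_iff, regularTarget, Set.mem_ofPred_eq, yawChain_shipMap]
  rfl

lemma shipInv_shipMap {p : Phase (Fin (4 + 4)) (Fin 2)} (hp : p ∈ regularSet) :
    shipInv (shipMap p) = p := by
  have htail : Fin.tail (yawJet p) = prolongedJet 4 4 1 p := rfl
  rw [shipInv, yawChain_shipMap, outputChain_shipMap, htail, outputJet, Matrix.mulVec_mulVec,
    Matrix.nonsing_inv_mul _ (mem_regularSet_iff.1 hp).isUnit, Matrix.one_mulVec]
  exact ofBody_bodyState p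

lemma shipMap_shipInv {w : Phase (SigState shipSig) (SigIndex shipSig)}
    (hw : w ∈ regularTarget) : shipMap (shipInv w) = w := by
  refine ext_chainJet rfl (forall_sigIndex_shipSig.2 ⟨(outputChain_shipMap _).trans ?_,
    (yawChain_shipMap _).trans ?_⟩)
  · rw [outputJet, shipInv, prolongedJet_ofBody, bodyState_ofBody, Matrix.mulVec_mulVec,
      Matrix.mul_nonsing_inv _ (IsUnit.mk0 _ hw), Matrix.one_mulVec]
    rfl
  · rw [yawJet, shipInv, prolongedJet_ofBody, baseState_ofBody]
    exact Fin.cons_self_tail (yawChain w)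

lemma contDiff_tail_yawChain : ContDiff ℝ ∞ fun w => Fin.tail (yawChain w) :=
  contDiff_pi.2 fun i => contDiff_pi.1 yawChain.contDiff i.succ

lemma isOpen_regularTarget : IsOpen regularTarget :=
  isOpen_ne_fun (Continuous.matrix_det <| continuous_matrix fun i j =>
    ((contDiff_outputMatrix i j).comp contDiff_tail_yawChain).continuous) continuous_const

lemma contDiffOn_shipInv : ContDiffOn ℝ ∞ shipInv regularTarget := by
  have hbody : ContDiffOn ℝ ∞
      (fun w => (outputMatrix (Fin.tail (yawChain w)))⁻¹.mulVec (outputChain w)) regularTarget :=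
    contDiffOn_inv_mulVec
      (fun i j => ((contDiff_outputMatrix i j).comp contDiff_tail_yawChain).contDiffOn)
      outputChain.contDiff.contDiffOn fun _ hw => hw
  exact contDiff_ofBody.comp_contDiffOn (contDiffOn_fst.prodMk
    ((contDiff_pi.1 yawChain.contDiff 0).contDiffOn.prodMk
      (hbody.prodMk contDiff_tail_yawChain.contDiffOn)))

/-- The static feedback transformation of the four-fold prolongation of the ship to
`C⟨0, 0, 1, 0, 1⟩`. -/
def shipDiffeo : OpenPartialHomeomorph (Phase (Fin 8) (Fin 2))
    (Phase (SigState shipSig) (SigIndex shipSig)) where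
  toFun := shipMap
  invFun := shipInv
  source := regularSet
  target := regularTarget
  map_source' _ hp := shipMap_mem_regularTarget_iff.2 hp
  map_target' _ hw := shipMap_mem_regularTarget_iff.1 ((shipMap_shipInv hw).symm ▸ hw)
  left_inv' _ hp := shipInv_shipMap hp
  right_inv' _ hw := shipMap_shipInv hw
  open_source := isOpen_regularSet
  open_target := isOpen_regularTarget
  continuousOn_toFun := contDiff_shipMap.continuous.continuousOn
  continuousOn_invFun := contDiffOn_shipInv.continuousOn

lemma shipMap_state_eq {p q : Phase (Fin (4 + 4)) (Fin 2)} (h : p.2.1 = q.2.1) :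
    (shipMap p).2.1 = (shipMap q).2.1 := by
  funext ⟨j, i⟩
  rw [← chainJet_castSucc, ← chainJet_castSucc]
  revert i
  revert j
  refine forall_sigIndex_shipSig.2 ⟨fun i => ?_, fun i => ?_⟩
  · have hjet := outputJet_castSucc_congr h i
    rwa [← outputChain_shipMap, ← outputChain_shipMap] at hjet
  · have hjet := yawJet_castSucc_congr h i
    rwa [← yawChain_shipMap, ← yawChain_shipMap] at hjet

lemma isStaticFeedback_shipDiffeo :
    IsStaticFeedback (shipPr 4) (contactSystem shipSig) shipDiffeo :=
  .of_contactMap contDiff_shipMap.contDiffOn contDiffOn_shipInv (by decide) (fun _ _ => rfl)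
    ⟨fun t x => (shipMap (t, x, 0)).2.1, fun _ _ _ _ => shipMap_state_eq rfl⟩

end ShipNormalForm

section ShipFlatness

lemma isOpen_regularJets : IsOpen regularJets := by
  unfold regularJets ell
  exact isOpen_ne_fun (by fun_prop) continuous_const

lemma dense_regularJets : Dense regularJets :=
  dense_ne_zero_of_finite_line (0, 0, Pi.single 0 (Pi.single 1 1)) fun p => by
    simpa using (finite_setOf_ell_eq_zero (p.2.2 1 1) (p.2.2 2 1)).preimage
      (add_right_injective (p.2.2 0 1)).injOn

lemma contDiff_shipFlatOutput : ContDiff ℝ ∞ shipFlatOutput := by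
  unfold shipFlatOutput outputA
  fun_prop

/-- The matching of the flat outputs `a` and `θ` with the dependent variables of the normal form. -/
def shipChain : Fin 2 ≃ SigIndex shipSig where
  toFun := ![idxA, idxTheta]
  invFun j := if j = idxA then 0 else 1
  left_inv := by decide
  right_inv := by decide

lemma isFlatOutputOn_shipFlatOutput : IsFlatOutputOn ship 2 regularJets shipFlatOutput := by
  refine isFlatOutputOn_of_isStaticFeedback (k := 4) (j := 1) isStaticFeedback_shipDiffeo
    (by decide) shipChain isOpen_regularJets contDiff_shipFlatOutput.contDiffOn
    (fun p q h => ?_) (fun p q h _ => Fin.forall_fin_two.2 ⟨?_, congrFun h.state 2⟩)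
  · simp only [regularJets, Set.mem_ofPred_eq, h.controlJet]
    rfl
  · refine Eq.trans ?_ (chainJet_contactMap shipOutputs idxA p 0).symm
    simp only [shipFlatOutput, Matrix.cons_val_zero, h.state, h.controlJet]
    rfl

lemma IsFlatOutputOn.isFlat {ι μ : Type} [Fintype ι] [Fintype μ] {S : ControlSystem ι μ} {r : ℕ}
    {Ω : Set (ControlJet ι μ r)} {h : ControlJet ι μ r → μ → ℝ} (hh : IsFlatOutputOn S r Ω h)
    (hΩ : Dense Ω) : IsFlat S :=
  ⟨r, Ω, hh.1, hΩ, fun _ hp => ⟨Ω, h, hp, hh⟩⟩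

end ShipFlatness

end ShipControl

end

theorem mainTheorem7 :
    -- four prolongations of `u₂` lead to `C⟨0,0,1,0,1⟩`, with outputs `a` and `θ`
    (IsOpen ShipControl.regularSet ∧ Dense ShipControl.regularSet ∧
      ∃ Φ : OpenPartialHomeomorph (ShipControl.Phase (Fin 8) (Fin 2))
          (ShipControl.Phase (ShipControl.SigState ShipControl.shipSig)
            (ShipControl.SigIndex ShipControl.shipSig)),
        Φ.source = ShipControl.regularSet ∧
        (∀ p ∈ ShipControl.regularSet,
          Φ p = ShipControl.contactMap (ShipControl.shipPr 4) ShipControl.shipSig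
            ShipControl.shipOutputs p) ∧
        ShipControl.IsStaticFeedback (ShipControl.shipPr 4)
          (ShipControl.contactSystem ShipControl.shipSig) Φ) ∧
    -- fewer than four prolongations of `u₂` do not suffice, near any point
    (∀ k < 4, ∀ p : ShipControl.Phase (Fin (4 + k)) (Fin 2),
      ¬ ShipControl.StaticFeedbackLinearizableAt (ShipControl.shipPr k) p) ∧
    -- the ship is flat, with flat output `(a, θ)`
    (IsOpen ShipControl.regularJets ∧ Dense ShipControl.regularJets ∧
      ShipControl.IsFlatOutputOn ShipControl.ship 2 ShipControl.regularJets
        ShipControl.shipFlatOutput) ∧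
    ShipControl.IsFlat ShipControl.ship := by
  open ShipControl in
  exact ⟨⟨isOpen_regularSet, dense_regularSet, shipDiffeo, rfl, fun _ _ => rfl,
      isStaticFeedback_shipDiffeo⟩,
    not_staticFeedbackLinearizableAt_shipPr,
    ⟨isOpen_regularJets, dense_regularJets, isFlatOutputOn_shipFlatOutput⟩,
    isFlatOutputOn_shipFlatOutput.isFlat dense_regularJets⟩
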